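/- Let $m>0$ and consider the equatorial Schwarzschild optical geometry, that is, the set $\{r>2m\}\subset\mathbb{R}^2$ with the Riemannian metric $$\bar g=\frac{dr^2}{(1-\frac{2m}{r})^2}+\frac{r^2\,d\varphi^2}{1-\frac{2m}{r}},$$ whose geodesics are called light rays and whose photon sphere is the circle $\{r=3m\}$. Call a curve admissible if it is a simple closed piecewise smooth curve in $\{r\ge 3m\}$ which is homologous in $\{r>2m\}$ to a circle $\{r=c\}$ (with either orientation); it then bounds, together with $\{r=3m\}$, a region $S\subset\{r\ge 3m\}$. For a given area $A$, an admissible curve bounds a solution of the isoperimetric problem if the region $S$ it bounds with $\{r=3m\}$ has area $|S|=A$ and if its length is least among all admissible curves that bound, with $\{r=3m\}$, the same area $A$. (Every area is that of an annulus $\{3m\le r\le c\}$ with $c\ge 3m$.) Then every light ray that bounds a solution of the isoperimetric problem lies on the photon sphere: if, for some $A$, a curve $\gamma:[a,b]\to\{r\ge 3m\}$ bounds a solution of the isoperimetric problem for the area $A$ and is a geodesic of $\bar g$ on $(a,b)$ (it is not assumed that $\gamma$ closes up smoothly at $\gamma(a)=\gamma(b)$), then $r(\gamma(t))=3m$ for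 all $t\in[a,b]$. -/

import Mathlib

open scoped ContDiff

noncomputable section

namespace SchwarzschildOptical

/-- The optical metric of the equatorial plane of the Schwarzschild solution of mass `m`, as the
matrix of its components in the coordinates `x = (r, φ)`, that is `x 0 = r` and `x 1 = φ`:
`dr² / (1 - 2m/r)² + r² dφ² / (1 - 2m/r)`. It is a Riemannian metric for `r > 2m`. -/
def metric (m : ℝ) (x : Fin 2 → ℝ) : Matrix (Fin 2) (Fin 2) ℝ :=
  !![1 / (1 - 2 * m / x 0) ^ 2, 0; 0, (x 0) ^ 2 / (1 - 2 * m / x 0)]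

/-- Partial derivative of `f` in the `i`-th coordinate at `x`. -/
def pderiv (i : Fin 2) (f : (Fin 2 → ℝ) → ℝ) (x : Fin 2 → ℝ) : ℝ :=
  deriv (fun s => f (Function.update x i s)) (x i)

/-- Christoffel symbol `Γ^k_{ij}` at `x` of the Levi-Civita connection of a metric `g` given by its
components in coordinates. -/
def christoffel (g : (Fin 2 → ℝ) → Matrix (Fin 2) (Fin 2) ℝ) (k i j : Fin 2) (x : Fin 2 → ℝ) : ℝ :=
  1 / 2 * ∑ l, (g x)⁻¹ k l *
    (pderiv i (fun y => g y j l) x + pderiv j (fun y => g y i l) x - pderiv l (fun y => g y i j) x)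

/-- The curve with coordinates `u = (r, φ)` is an (affinely parametrized) geodesic of the optical
metric, that is a light ray, on the open set of parameters `s`. The angular coordinate takes values
in `ℝ`: it is the continuous lift of the polar angle along the curve. -/
def IsLightRayOn (m : ℝ) (u : ℝ → Fin 2 → ℝ) (s : Set ℝ) : Prop :=
  ContDiffOn ℝ 2 u s ∧ ∀ t ∈ s, 2 * m < u t 0 ∧ ∀ k,
    deriv (deriv u) t k +
      ∑ i, ∑ j, christoffel (metric m) k i j (u t) * deriv u t i * deriv u t j = 0

/-- The point of the plane with polar coordinates `x = (r, φ)`, `φ` being any real number. -/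
def toPlane (x : Fin 2 → ℝ) : ℝ × ℝ := (x 0 * Real.cos (x 1), x 0 * Real.sin (x 1))

/-- Piecewise smooth (and continuous) on `[a, b]`: smooth up to the end points on each of the
closed intervals of a finite subdivision. -/
def PiecewiseSmoothOn (u : ℝ → Fin 2 → ℝ) (a b : ℝ) : Prop :=
  ∃ (n : ℕ) (t : ℕ → ℝ), t 0 = a ∧ t n = b ∧
    ∀ i < n, t i < t (i + 1) ∧ ContDiffOn ℝ ∞ u (Set.Icc (t i) (t (i + 1)))

/-- Optical length of the curve `u` on `[a, b]`. -/
def length (m a b : ℝ) (u : ℝ → Fin 2 → ℝ) : ℝ :=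
  ∫ t in a..b, Real.sqrt (∑ i, ∑ j, metric m (u t) i j * deriv u t i * deriv u t j)

/-- Optical area of a set `S` in the plane, the integral over `S` of `√(det g) dr dφ`. -/
def area (m : ℝ) (S : Set (ℝ × ℝ)) : ENNReal :=
  ∫⁻ p in {p : ℝ × ℝ | p ∈ polarCoord.target ∧ polarCoord.symm p ∈ S},
    ENNReal.ofReal (Real.sqrt (metric m ![p.1, p.2]).det)

/-- The closed Jordan domain of a simple closed curve with trace `C`: the points which cannot escape
to infinity without crossing `C`. (The component of a point of `C` is empty by convention, so `C`
itself is contained in this set.) -/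
def jordanDomain (C : Set (ℝ × ℝ)) : Set (ℝ × ℝ) :=
  {p | Bornology.IsBounded (connectedComponentIn Cᶜ p)}

/-- The set bounded by the curve `u` on `[a, b]` together with the photon sphere `{r = 3m}`. -/
def boundedRegion (m a b : ℝ) (u : ℝ → Fin 2 → ℝ) : Set (ℝ × ℝ) :=
  {p ∈ jordanDomain ((fun t => toPlane (u t)) '' Set.Icc a b) |
    3 * m ≤ Real.sqrt (p.1 ^ 2 + p.2 ^ 2)}

/-- The curves of the isoperimetric problem: simple closed piecewise smooth curves in `{r ≥ 3m}`
that are homologous there to a circle `{r = c}` (with one of its two orientations), that is, that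
wind once around the origin. No smoothness is required where the curve closes up. -/
structure IsAdmissible (m a b : ℝ) (u : ℝ → Fin 2 → ℝ) : Prop where
  lt : a < b
  piecewiseSmooth : PiecewiseSmoothOn u a b
  outside : ∀ t ∈ Set.Icc a b, 3 * m ≤ u t 0
  closed : u b 0 = u a 0
  winding : u b 1 = u a 1 + 2 * Real.pi ∨ u b 1 = u a 1 - 2 * Real.pi
  simple : Set.InjOn (fun t => toPlane (u t)) (Set.Ico a b)

/-- The curve `u` on `[a, b]` bounds a solution of the isoperimetric problem for the area `A`: it
has least length among the admissible curves that bound the area `A` with `{r = 3m}`. -/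
structure IsIsoperimetricSolution (m : ℝ) (A : ENNReal) (a b : ℝ) (u : ℝ → Fin 2 → ℝ) : Prop where
  admissible : IsAdmissible m a b u
  area_eq : area m (boundedRegion m a b u) = A
  length_le : ∀ (a' b' : ℝ) (v : ℝ → Fin 2 → ℝ), IsAdmissible m a' b' v →
    area m (boundedRegion m a' b' v) = A → length m a b u ≤ length m a' b' v

end SchwarzschildOptical

end

noncomputable section

namespace SchwarzschildOptical

/-! Angular momentum `J` and energy `E` are conserved along a light ray. A full turn forces `J ≠ 0`,
so the angle is strictly monotone and the ray is a polar graph. If its radius is constant, the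
radial geodesic equation puts it on the photon sphere.

If the radius `r` varies, two deformations on the same parameter interval combine into a shorter
curve bounding the same area. Let `q` be `invSqRadius` along the ray, the reciprocal of the angular
metric coefficient, and `μ` the `q`-weighted mean of `r`. Multiplying the angular speed by `1 + δ (r
- μ)` keeps the total angle. It sweeps more angle at large radii, so the area grows at order `δ`
(Chebyshev), while the energy grows only at order `δ ^ 2`, because the linear term is a constant
times the integral of `q (r - μ)`. Scaling `r - 3m` by `s` in `[0, 1]` then removes area and lowers
the energy by at least a multiple of `1 - s`: the radial part does not grow (`radial_shrink_le`),
and `1 / q` lies below the chord to its minimum `27 m ^ 2` (`angular_shrink_le`).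

The intermediate value theorem gives an `s` that restores the area, and Lipschitz dependence of the
area on `s` makes `1 - s` at least a multiple of `δ`; for small `δ` the gain beats the cost
(`exists_area_preserving_shrink`). The ray has constant speed, so by Cauchy–Schwarz less energy
means less length (`IsLightRayOn.exists_shorter`). No variation formula with boundary terms is used,
so a corner at the closing point is harmless. -/

/-! ### Geodesic equations and conserved quantities. -/

lemma metric_inv (m : ℝ) (x : Fin 2 → ℝ) (h0 : x 0 ≠ 0) (h1 : 1 - 2 * m / x 0 ≠ 0) :
    (metric m x)⁻¹ = !![(1 - 2 * m / x 0) ^ 2, 0; 0, (1 - 2 * m / x 0) / (x 0) ^ 2] := by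
  apply Matrix.inv_eq_right_inv
  rw [metric]
  generalize 1 - 2 * m / x 0 = f at h1
  ext i j
  fin_cases i <;> fin_cases j <;> simp [h0, h1]

lemma one_sub_div_pos {m x : ℝ} (hm : 0 < m) (hx : 2 * m < x) : 0 < 1 - 2 * m / x := by
  have : 0 < x := by linarith
  rw [sub_pos, div_lt_one this]; exact hx

lemma pderiv_metric_radial {m : ℝ} (hm : 0 < m) (x : Fin 2 → ℝ) (hx : 2 * m < x 0) :
    pderiv 0 (fun y => metric m y 0 0) x = -(4 * m * x 0) / (x 0 - 2 * m) ^ 3 := by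
  have h0 : x 0 ≠ 0 := by linarith
  have h1 : x 0 - 2 * m ≠ 0 := by linarith
  have h2 := (one_sub_div_pos hm hx).ne'
  have : HasDerivAt (fun s : ℝ => 1 / (1 - 2 * m / s) ^ 2)
      (-(4 * m * x 0) / (x 0 - 2 * m) ^ 3) (x 0) := by
    have h := (((hasDerivAt_const (x 0) (2 * m)).div (hasDerivAt_id (x 0)) h0).const_sub 1)
    have h' := (hasDerivAt_const (x 0) (1 : ℝ)).div (h.pow 2) (pow_ne_zero 2 h2)
    refine h'.congr_deriv ?_
    simp only [Pi.pow_apply, Pi.div_apply, id, Nat.cast_ofNat]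
    have : 1 - 2 * m / x 0 = (x 0 - 2 * m) / x 0 := by field_simp
    rw [this]
    field_simp
    ring_nf
    field_simp
    ring
  simpa [pderiv, metric] using this.deriv

lemma pderiv_metric_angular {m : ℝ} (hm : 0 < m) (x : Fin 2 → ℝ) (hx : 2 * m < x 0) :
    pderiv 0 (fun y => metric m y 1 1) x =
      2 * (x 0) ^ 2 * (x 0 - 3 * m) / (x 0 - 2 * m) ^ 2 := by
  have h0 : x 0 ≠ 0 := by linarith
  have h1 : x 0 - 2 * m ≠ 0 := by linarith
  have h2 := (one_sub_div_pos hm hx).ne'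
  have : HasDerivAt (fun s : ℝ => s ^ 2 / (1 - 2 * m / s))
      (2 * (x 0) ^ 2 * (x 0 - 3 * m) / (x 0 - 2 * m) ^ 2) (x 0) := by
    have h := (((hasDerivAt_const (x 0) (2 * m)).div (hasDerivAt_id (x 0)) h0).const_sub 1)
    have h' := ((hasDerivAt_id (x 0)).pow 2).div h h2
    refine h'.congr_deriv ?_
    simp only [Pi.pow_apply, Pi.div_apply, id, Nat.cast_ofNat]
    have : 1 - 2 * m / x 0 = (x 0 - 2 * m) / x 0 := by field_simp
    rw [this]
    field_simp
    ring
  simpa [pderiv, metric] using this.deriv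

/-- Velocity `y` and acceleration `z` are plain data, so only algebra remains once the Christoffel
symbols are inserted. The factor `x 0 - 3 * m` is what singles out the photon sphere. -/
lemma geodesic_radial {m : ℝ} (hm : 0 < m) (x y : Fin 2 → ℝ) (hx : 2 * m < x 0) (z : ℝ)
    (h : z + ∑ i, ∑ j, christoffel (metric m) 0 i j x * y i * y j = 0) :
    z = 2 * m / (x 0 * (x 0 - 2 * m)) * y 0 ^ 2 + (x 0 - 3 * m) * y 1 ^ 2 := by
  have h0 : x 0 ≠ 0 := by linarith
  have h1 : x 0 - 2 * m ≠ 0 := by linarith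
  have h2 := (one_sub_div_pos hm hx).ne'
  have e1 := pderiv_metric_radial hm x hx
  have e2 := pderiv_metric_angular hm x hx
  simp only [christoffel, metric_inv m x h0 h2, Fin.sum_univ_two, e1, e2] at h
  simp [pderiv, metric] at h
  rw [show 1 - 2 * m / x 0 = (x 0 - 2 * m) / x 0 by field_simp] at h
  rw [eq_neg_of_add_eq_zero_left h]
  field_simp
  ring

lemma geodesic_angular {m : ℝ} (hm : 0 < m) (x y : Fin 2 → ℝ) (hx : 2 * m < x 0) (z : ℝ)
    (h : z + ∑ i, ∑ j, christoffel (metric m) 1 i j x * y i * y j = 0) :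
    z = - (2 * (x 0 - 3 * m) / (x 0 * (x 0 - 2 * m))) * y 0 * y 1 := by
  have h0 : x 0 ≠ 0 := by linarith
  have h1 : x 0 - 2 * m ≠ 0 := by linarith
  have h2 := (one_sub_div_pos hm hx).ne'
  have e1 := pderiv_metric_radial hm x hx
  have e2 := pderiv_metric_angular hm x hx
  simp only [christoffel, metric_inv m x h0 h2, Fin.sum_univ_two, e1, e2] at h
  simp [pderiv, metric] at h
  rw [show 1 - 2 * m / x 0 = (x 0 - 2 * m) / x 0 by field_simp] at h
  rw [eq_neg_of_add_eq_zero_left h]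
  field_simp
  ring

/-- The reciprocal of the squared circumference radius `r ^ 2 / (1 - 2 * m / r)`. -/
def invSqRadius (m x : ℝ) : ℝ := (x - 2 * m) / x ^ 3

lemma IsLightRayOn.hasDerivAt {m : ℝ} {u : ℝ → Fin 2 → ℝ} {s : Set ℝ} (hs : IsOpen s)
    (h : IsLightRayOn m u s) {t : ℝ} (ht : t ∈ s) (k : Fin 2) :
    HasDerivAt (fun t => u t k) (deriv u t k) t ∧
      HasDerivAt (fun t => deriv u t k) (deriv (deriv u) t k) t := by
  have h1 : DifferentiableAt ℝ u t :=
    (h.1.differentiableOn (by norm_num)).differentiableAt (hs.mem_nhds ht)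
  have h2 : DifferentiableAt ℝ (deriv u) t :=
    ((h.1.deriv_of_isOpen (m := 1) hs (by norm_num)).differentiableOn
      (by norm_num)).differentiableAt (hs.mem_nhds ht)
  exact ⟨hasDerivAt_pi.1 h1.hasDerivAt k, hasDerivAt_pi.1 h2.hasDerivAt k⟩

/-- Conservation of angular momentum and energy along a light ray. -/
lemma IsLightRayOn.conserved {m a b : ℝ} (hm : 0 < m) {u : ℝ → Fin 2 → ℝ}
    (h : IsLightRayOn m u (Set.Ioo a b)) :
    ∃ J E : ℝ, ∀ t ∈ Set.Ioo a b, deriv u t 1 = J * invSqRadius m (u t 0) ∧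
      deriv u t 0 ^ 2 = (1 - 2 * m / u t 0) ^ 2 * (E - J ^ 2 * invSqRadius m (u t 0)) := by
  -- Angular momentum and energy, with the angular metric coefficient written as `r ^ 3 / (r - 2m)`
  -- and the radial one as `(r / (r - 2m)) ^ 2`.
  have key : ∀ t ∈ Set.Ioo a b,
      HasDerivAt (fun t => deriv u t 1 * (u t 0 ^ 3 / (u t 0 - 2 * m))) 0 t ∧
      HasDerivAt (fun t => deriv u t 0 ^ 2 * (u t 0 / (u t 0 - 2 * m)) ^ 2 +
        deriv u t 1 ^ 2 * (u t 0 ^ 3 / (u t 0 - 2 * m))) 0 t := by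
    intro t ht
    obtain ⟨h2m, hk⟩ := h.2 t ht
    have hr := geodesic_radial hm _ _ h2m _ (hk 0)
    have hp := geodesic_angular hm _ _ h2m _ (hk 1)
    obtain ⟨r1, r2⟩ := h.hasDerivAt isOpen_Ioo ht 0
    obtain ⟨p1, p2⟩ := h.hasDerivAt isOpen_Ioo ht 1
    have h0 : u t 0 ≠ 0 := by linarith
    have h1 : u t 0 - 2 * m ≠ 0 := by linarith
    have g := (r1.pow 3).div (r1.sub_const (2 * m)) h1
    have g' := (r1.div (r1.sub_const (2 * m)) h1).pow 2
    constructor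
    · refine (p2.mul g).congr_deriv ?_
      simp only [Pi.pow_apply, Pi.div_apply, Nat.cast_ofNat]
      rw [hp]
      field_simp
      ring
    · refine (((r2.pow 2).mul g').add ((p2.pow 2).mul g)).congr_deriv ?_
      simp only [Pi.pow_apply, Pi.div_apply, Nat.cast_ofNat]
      rw [hp, hr]
      have h1' : u t 0 - m * 2 ≠ 0 := by linarith
      field_simp
      ring_nf
      field_simp
      ring
  obtain ⟨J, hJ⟩ := isOpen_Ioo.exists_is_const_of_deriv_eq_zero isPreconnected_Ioo
    (fun t ht => (key t ht).1.differentiableAt.differentiableWithinAt)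
    (fun t ht => (key t ht).1.deriv)
  obtain ⟨E, hE⟩ := isOpen_Ioo.exists_is_const_of_deriv_eq_zero isPreconnected_Ioo
    (fun t ht => (key t ht).2.differentiableAt.differentiableWithinAt)
    (fun t ht => (key t ht).2.deriv)
  refine ⟨J, E, fun t ht => ?_⟩
  have h2m := (h.2 t ht).1
  have h0 : u t 0 ≠ 0 := by linarith
  have h1 : u t 0 - 2 * m ≠ 0 := by linarith
  rw [← hJ t ht, ← hE t ht, invSqRadius, show 1 - 2 * m / u t 0 = (u t 0 - 2 * m) / u t 0 by
    field_simp]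
  constructor
  · field_simp
  · field_simp
    ring

/-- A circular light ray of non-zero angular momentum is the photon sphere. -/
lemma IsLightRayOn.eq_of_const {m a b c : ℝ} (hm : 0 < m) {u : ℝ → Fin 2 → ℝ}
    (h : IsLightRayOn m u (Set.Ioo a b)) (hc : ∀ t ∈ Set.Ioo a b, u t 0 = c) {t : ℝ}
    (ht : t ∈ Set.Ioo a b) (h1 : deriv u t 1 ≠ 0) : c = 3 * m := by
  have hd : ∀ s ∈ Set.Ioo a b, deriv u s 0 = 0 := fun s hs => by
    rw [← (h.hasDerivAt isOpen_Ioo hs 0).1.deriv, Filter.EventuallyEq.deriv_eq (f := fun _ => c)]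
    · simp
    · filter_upwards [isOpen_Ioo.mem_nhds hs] with x hx using hc x hx
  have hdd : deriv (deriv u) t 0 = 0 := by
    rw [← (h.hasDerivAt isOpen_Ioo ht 0).2.deriv, Filter.EventuallyEq.deriv_eq (f := fun _ => 0)]
    · simp
    · filter_upwards [isOpen_Ioo.mem_nhds ht] with x hx using hd x hx
  have hr := geodesic_radial hm _ _ (h.2 t ht).1 _ ((h.2 t ht).2 0)
  rw [hdd, hd t ht, hc t ht] at hr
  have : (c - 3 * m) * deriv u t 1 ^ 2 = 0 := by linarith
  rcases mul_eq_zero.1 this with h' | h'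
  · linarith
  · exact absurd (pow_eq_zero_iff (by norm_num) |>.1 h') h1

/-! ### Polar graphs and their Jordan domains. -/

/-- A function of a closed parameter interval that is compatible with a continuous surjection onto
the circle descends to a continuous function on the circle. -/
lemma exists_continuous_angle {a b : ℝ} {r φ : ℝ → ℝ} (hr : ContinuousOn r (Set.Icc a b))
    (hφ : ContinuousOn φ (Set.Icc a b))
    (hinj : ∀ s ∈ Set.Icc a b, ∀ t ∈ Set.Icc a b, (φ s : Real.Angle) = φ t → r s = r t)
    (hsurj : ∀ θ : Real.Angle, ∃ t ∈ Set.Icc a b, (φ t : Real.Angle) = θ) :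
    ∃ R : Real.Angle → ℝ, Continuous R ∧ ∀ t ∈ Set.Icc a b, R (φ t) = r t := by
  choose τ hτ hτφ using hsurj
  have hR : ∀ t ∈ Set.Icc a b, r (τ (φ t)) = r t := fun t ht =>
    hinj _ (hτ _) _ ht (hτφ _)
  refine ⟨fun θ => r (τ θ), ?_, hR⟩
  let q : Set.Icc a b → Real.Angle := fun t => (φ t : Real.Angle)
  have hq : Continuous q := Real.Angle.continuous_coe.comp hφ.domRestrict
  have hqs : Function.Surjective q := fun θ => ⟨⟨τ θ, hτ θ⟩, hτφ θ⟩
  -- A continuous surjection from a compact space onto a Hausdorff space is closed, hence a quotient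
  -- map.
  have : Topology.IsQuotientMap q := hq.isClosedMap.isQuotientMap hq hqs
  rw [this.continuous_iff]
  have : (fun θ => r (τ θ)) ∘ q = (Set.Icc a b).domRestrict r := by
    ext t
    exact hR t t.2
  rw [this]
  exact hr.domRestrict

/-- The distance from the origin in the coordinate plane. -/
def planeRadius (p : ℝ × ℝ) : ℝ := Real.sqrt (p.1 ^ 2 + p.2 ^ 2)

/-- The polar angle in the coordinate plane. -/
def planeAngle (p : ℝ × ℝ) : Real.Angle := (Complex.arg ⟨p.1, p.2⟩ : Real.Angle)

lemma planeRadius_eq_norm (p : ℝ × ℝ) : planeRadius p = ‖(⟨p.1, p.2⟩ : ℂ)‖ := by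
  rw [Complex.norm_def, Complex.normSq_mk, planeRadius, sq, sq]

lemma continuous_planeRadius : Continuous planeRadius := by
  unfold planeRadius; fun_prop

lemma planeRadius_toPlane {x : Fin 2 → ℝ} (hx : 0 ≤ x 0) : planeRadius (toPlane x) = x 0 := by
  rw [planeRadius, toPlane, Real.sqrt_eq_iff_mul_self_eq (by positivity) hx]
  linear_combination ((x 0) ^ 2) * Real.sin_sq_add_cos_sq (x 1)

lemma planeAngle_toPlane {x : Fin 2 → ℝ} (hx : 0 < x 0) : planeAngle (toPlane x) = x 1 := by
  rw [planeAngle, ← Complex.arg_mul_cos_add_sin_mul_I_coe_angle hx (x 1)]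
  congr 2
  apply Complex.ext <;> simp [toPlane, Complex.cos_ofReal_re, Complex.sin_ofReal_re]

lemma toPlane_eq {p : ℝ × ℝ} {x : Fin 2 → ℝ} (h0 : x 0 = planeRadius p)
    (h1 : (x 1 : Real.Angle) = planeAngle p) : toPlane x = p := by
  rw [toPlane, h0, ← Real.Angle.cos_coe, ← Real.Angle.sin_coe, h1, planeAngle, Real.Angle.cos_coe,
    Real.Angle.sin_coe, planeRadius_eq_norm, Complex.norm_mul_cos_arg, Complex.norm_mul_sin_arg]

lemma continuousAt_planeAngle {p : ℝ × ℝ} (hp : 0 < planeRadius p) :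
    ContinuousAt planeAngle p := by
  have h : (⟨p.1, p.2⟩ : ℂ) ≠ 0 := by
    rw [← norm_pos_iff, ← planeRadius_eq_norm]; exact hp
  have hc : ContinuousAt (fun p : ℝ × ℝ => (⟨p.1, p.2⟩ : ℂ)) p :=
    Complex.equivRealProdCLM.symm.continuous.continuousAt
  exact ContinuousAt.comp (f := fun p : ℝ × ℝ => (⟨p.1, p.2⟩ : ℂ))
    (Complex.continuousAt_arg_coe_angle h) hc

lemma planeRadius_smul {c : ℝ} (hc : 0 < c) (p : ℝ × ℝ) :
    planeRadius (c • p) = c * planeRadius p := by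
  rw [planeRadius, planeRadius, Prod.smul_fst, Prod.smul_snd, smul_eq_mul, smul_eq_mul,
    show (c * p.1) ^ 2 + (c * p.2) ^ 2 = c ^ 2 * (p.1 ^ 2 + p.2 ^ 2) by ring,
    Real.sqrt_mul (by positivity), Real.sqrt_sq hc.le]

lemma planeAngle_smul {c : ℝ} (hc : 0 < c) (p : ℝ × ℝ) : planeAngle (c • p) = planeAngle p := by
  rw [planeAngle, planeAngle, ← Complex.arg_real_mul ⟨p.1, p.2⟩ hc]
  congr 2
  apply Complex.ext <;> simp

/-- The norm of `ℝ × ℝ` is the sup norm; this bound and `planeRadius_le` carry boundedness over to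
the Euclidean radius and back. -/
lemma norm_le_planeRadius (p : ℝ × ℝ) : ‖p‖ ≤ planeRadius p := by
  rw [planeRadius, Prod.norm_def, max_le_iff]
  exact ⟨Real.abs_le_sqrt (by nlinarith [sq_nonneg p.2]),
    Real.abs_le_sqrt (by nlinarith [sq_nonneg p.1])⟩

lemma planeRadius_le (p : ℝ × ℝ) : planeRadius p ≤ 2 * ‖p‖ := by
  have h1 := norm_fst_le p
  have h2 := norm_snd_le p
  rw [Real.norm_eq_abs] at h1 h2
  apply Real.sqrt_le_iff.2 ⟨by positivity, ?_⟩
  nlinarith [abs_nonneg p.1, abs_nonneg p.2, sq_abs p.1, sq_abs p.2, norm_nonneg p]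

/-- The closed Jordan domain of a polar graph. -/
lemma mem_jordanDomain_iff {C : Set (ℝ × ℝ)} {R : Real.Angle → ℝ} (hR : Continuous R) {c M : ℝ}
    (hc : 0 < c) (hcR : ∀ θ, c ≤ R θ) (hM : ∀ θ, R θ ≤ M)
    (hC : C = {q | planeRadius q = R (planeAngle q)}) (p : ℝ × ℝ) :
    p ∈ jordanDomain C ↔ planeRadius p ≤ R (planeAngle p) := by
  set D : Set (ℝ × ℝ) := {q | planeRadius q < R (planeAngle q)} with hD
  set D' : Set (ℝ × ℝ) := {q | R (planeAngle q) < planeRadius q} with hD'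
  have hcont : ∀ q, 0 < planeRadius q → ContinuousAt (fun q => R (planeAngle q)) q := fun q hq =>
    hR.continuousAt.comp (continuousAt_planeAngle hq)
  have hDo : IsOpen D := by
    rw [isOpen_iff_mem_nhds]
    intro q hq
    -- The angle is not continuous at the origin, but all points of radius less than `c` lie in `D`
    -- whatever their angle.
    by_cases h : 0 < planeRadius q
    · exact continuous_planeRadius.continuousAt.eventually_lt (hcont q h) hq
    · have : {q | planeRadius q < c} ∈ nhds q :=
        (isOpen_lt continuous_planeRadius continuous_const).mem_nhds (lt_of_le_of_lt (not_lt.1 h) hc)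
      filter_upwards [this] with x hx using lt_of_lt_of_le hx (hcR _)
  have hDo' : IsOpen D' := by
    rw [isOpen_iff_mem_nhds]
    intro q hq
    have h : 0 < planeRadius q := lt_trans (lt_of_lt_of_le hc (hcR _)) hq
    exact (hcont q h).eventually_lt continuous_planeRadius.continuousAt hq
  have hDC : D ⊆ Cᶜ := fun q hq h => by rw [hC] at h; exact absurd h (ne_of_lt hq)
  have hDC' : D' ⊆ Cᶜ := fun q hq h => by rw [hC] at h; exact absurd h (ne_of_gt hq)
  have hdisj : Disjoint D D' := Set.disjoint_left.2 fun q h h' => lt_asymm (show planeRadius q < _ from h) h'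
  have hcov : Cᶜ ⊆ D ∪ D' := fun q hq => by
    rw [hC] at hq
    exact lt_or_gt_of_ne hq
  rcases lt_trichotomy (planeRadius p) (R (planeAngle p)) with h | h | h
  · refine ⟨fun _ => h.le, fun _ => ?_⟩
    have hsub : connectedComponentIn Cᶜ p ⊆ D :=
      isPreconnected_connectedComponentIn.subset_left_of_subset_union hDo hDo' hdisj
        ((connectedComponentIn_subset _ _).trans hcov)
        ⟨p, mem_connectedComponentIn (hDC h), h⟩
    refine (Metric.isBounded_closedBall (x := (0 : ℝ × ℝ)) (r := M)).subset (hsub.trans ?_)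
    intro q hq
    rw [mem_closedBall_zero_iff]
    exact (norm_le_planeRadius q).trans (le_trans (le_of_lt hq) (hM _))
  · refine ⟨fun _ => h.le, fun _ => ?_⟩
    have : p ∉ Cᶜ := by rw [hC]; simpa using h
    rw [jordanDomain, Set.mem_ofPred_eq, connectedComponentIn_eq_empty this]
    exact Bornology.isBounded_empty
  · refine ⟨fun hb => ?_, fun h' => absurd h (not_lt.2 h')⟩
    exfalso
    have hb : Bornology.IsBounded (connectedComponentIn Cᶜ p) := hb
    have hp : 0 < planeRadius p := lt_trans (lt_of_lt_of_le hc (hcR _)) h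
    -- The outward radial half-line keeps its angle while its radius grows, so it escapes to
    -- infinity without meeting the graph.
    have hray : (fun l : ℝ => l • p) '' Set.Ici 1 ⊆ connectedComponentIn Cᶜ p := by
      apply IsPreconnected.subset_connectedComponentIn
      · exact isPreconnected_Ici.image _ (by fun_prop)
      · exact ⟨1, Set.self_mem_Ici, one_smul _ _⟩
      · rintro _ ⟨l, hl, rfl⟩
        have hl' : (1 : ℝ) ≤ l := hl
        apply hDC'
        change R _ < _
        rw [planeRadius_smul (by linarith), planeAngle_smul (by linarith)]
        nlinarith
    obtain ⟨K, hK⟩ := (Metric.isBounded_iff_subset_closedBall (0 : ℝ × ℝ)).1 (hb.subset hray)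
    have hK' : ∀ l : ℝ, 1 ≤ l → l * planeRadius p ≤ 2 * K := fun l hl => by
      have := mem_closedBall_zero_iff.1 (hK ⟨l, hl, rfl⟩)
      rw [← planeRadius_smul (by linarith)]
      exact (planeRadius_le _).trans (by linarith)
    have h2 := hK' (max 1 ((2 * K + 1) / planeRadius p)) (le_max_left _ _)
    have h3 := mul_le_mul_of_nonneg_right (le_max_right 1 ((2 * K + 1) / planeRadius p)) hp.le
    rw [div_mul_cancel₀ _ hp.ne'] at h3
    linarith

/-! ### Optical area of polar regions. -/

/-- The area density of the optical metric in the coordinates `(r, φ)`. -/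
def areaDensity (m x : ℝ) : ℝ := Real.sqrt (1 / (1 - 2 * m / x) ^ 2 * (x ^ 2 / (1 - 2 * m / x)))

/-- The area, per unit angle, of the sector between the photon sphere and the radius `x`. -/
def sectorArea (m x : ℝ) : ℝ := ∫ y in (3 * m)..x, areaDensity m y

lemma sqrt_det_metric (m : ℝ) (x : Fin 2 → ℝ) :
    Real.sqrt (metric m x).det = areaDensity m (x 0) := by
  rw [metric, Matrix.det_fin_two_of, areaDensity]; simp

lemma areaDensity_pos {m x : ℝ} (hm : 0 < m) (hx : 2 * m < x) : 0 < areaDensity m x := by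
  have := one_sub_div_pos hm hx
  have : 0 < x := by linarith
  exact Real.sqrt_pos.2 (by positivity)

lemma continuousOn_areaDensity {m : ℝ} (hm : 0 < m) :
    ContinuousOn (areaDensity m) (Set.Ioi (2 * m)) := by
  intro x hx
  have h1 := (one_sub_div_pos hm hx).ne'
  have h2 : x ≠ 0 := by have : 2 * m < x := hx; linarith
  have h3 := pow_ne_zero 2 h1
  unfold areaDensity
  apply ContinuousAt.continuousWithinAt
  fun_prop (disch := assumption)

lemma intervalIntegrable_areaDensity {m x y : ℝ} (hm : 0 < m) (hx : 3 * m ≤ x) (hy : 3 * m ≤ y) :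
    IntervalIntegrable (areaDensity m) MeasureTheory.volume x y :=
  ((continuousOn_areaDensity hm).mono fun z hz => by
    have h : 3 * m ≤ z := (le_inf hx hy).trans hz.1
    exact show 2 * m < z by linarith).intervalIntegrable

lemma sectorArea_sub {m x y : ℝ} (hm : 0 < m) (hx : 3 * m ≤ x) (hy : 3 * m ≤ y) :
    sectorArea m y - sectorArea m x = ∫ z in x..y, areaDensity m z :=
  intervalIntegral.integral_interval_sub_left (intervalIntegrable_areaDensity hm le_rfl hy)
    (intervalIntegrable_areaDensity hm le_rfl hx)

lemma sectorArea_strictMonoOn {m : ℝ} (hm : 0 < m) :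
    StrictMonoOn (sectorArea m) (Set.Ici (3 * m)) := by
  intro x hx y hy hxy
  rw [← sub_pos, sectorArea_sub hm hx hy]
  refine intervalIntegral.intervalIntegral_pos_of_pos_on
    (intervalIntegrable_areaDensity hm hx hy) (fun z hz => areaDensity_pos hm ?_) hxy
  have : 3 * m ≤ x := hx
  linarith [hz.1]

lemma sectorArea_nonneg {m x : ℝ} (hm : 0 < m) (hx : 3 * m ≤ x) : 0 ≤ sectorArea m x := by
  have := (sectorArea_strictMonoOn hm).monotoneOn (Set.self_mem_Ici) hx hx
  simpa [sectorArea] using this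

/-- The density is bounded on compact sets away from the horizon. This controls the area lost by
shrinking linearly in the displacement. -/
lemma exists_sectorArea_lipschitz {m : ℝ} (hm : 0 < m) (M : ℝ) :
    ∃ C : ℝ, 0 < C ∧ ∀ x ∈ Set.Icc (3 * m) M, ∀ y ∈ Set.Icc (3 * m) M,
      |sectorArea m y - sectorArea m x| ≤ C * |y - x| := by
  have hsub : Set.Icc (3 * m) M ⊆ Set.Ioi (2 * m) := fun z hz => by
    exact show 2 * m < z by linarith [hz.1]
  obtain ⟨C, hC⟩ := isCompact_Icc.exists_bound_of_continuousOn
    ((continuousOn_areaDensity hm).mono hsub)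
  refine ⟨max C 1, by positivity, fun x hx y hy => ?_⟩
  rw [sectorArea_sub hm hx.1 hy.1]
  rw [← Real.norm_eq_abs]
  refine intervalIntegral.norm_integral_le_of_norm_le_const fun z hz => ?_
  exact (hC z (Set.uIcc_subset_Icc hx hy (Set.uIoc_subset_uIcc hz))).trans (le_max_left _ _)

lemma continuousOn_sectorArea {m : ℝ} (hm : 0 < m) :
    ContinuousOn (sectorArea m) (Set.Ici (3 * m)) := by
  intro x hx
  have h : 3 * m ≤ x := hx
  have hd : HasDerivAt (sectorArea m) (areaDensity m x) x := by
    have hx2 : Set.Ioi (2 * m) ∈ nhds x := Ioi_mem_nhds (by linarith)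
    exact intervalIntegral.integral_hasDerivAt_right
      (intervalIntegrable_areaDensity hm le_rfl h)
      ((continuousOn_areaDensity hm).stronglyMeasurableAtFilter isOpen_Ioi _
        (show 2 * m < x by linarith))
      ((continuousOn_areaDensity hm).continuousAt hx2)
  exact hd.continuousAt.continuousWithinAt

/-- The optical area between the photon sphere and a polar graph. -/
lemma area_polar_region {m : ℝ} (hm : 0 < m) {R : Real.Angle → ℝ} (hR : Continuous R)
    (hR3 : ∀ θ, 3 * m ≤ R θ) :
    area m {p | 3 * m ≤ planeRadius p ∧ planeRadius p ≤ R (planeAngle p)} =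
      ENNReal.ofReal (∫ θ in (-Real.pi)..Real.pi, sectorArea m (R θ)) := by
  have hRc : Continuous fun θ : ℝ => R θ := hR.comp Real.Angle.continuous_coe
  set T : Set (ℝ × ℝ) :=
    {p | p.2 ∈ Set.Ioo (-Real.pi) Real.pi ∧ 3 * m ≤ p.1 ∧ p.1 ≤ R p.2} with hT
  have hset : {p : ℝ × ℝ | p ∈ polarCoord.target ∧ polarCoord.symm p ∈
      {p | 3 * m ≤ planeRadius p ∧ planeRadius p ≤ R (planeAngle p)}} = T := by
    ext p
    simp only [polarCoord_target, Set.mem_prod, Set.mem_Ioi, Set.mem_ofPred_eq, hT]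
    have h1 : ∀ hp : 0 < p.1, planeRadius (polarCoord.symm p) = p.1 := fun hp =>
      planeRadius_toPlane (x := ![p.1, p.2]) hp.le
    have h2 : ∀ hp : 0 < p.1, planeAngle (polarCoord.symm p) = p.2 := fun hp =>
      planeAngle_toPlane (x := ![p.1, p.2]) hp
    constructor
    · rintro ⟨⟨h, h'⟩, h3, h4⟩
      rw [h1 h] at h3 h4
      rw [h2 h] at h4
      exact ⟨h', h3, h4⟩
    · rintro ⟨h', h3, h4⟩
      have h : 0 < p.1 := by linarith
      rw [h1 h, h2 h]
      exact ⟨⟨h, h'⟩, h3, h4⟩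
  have hTm : MeasurableSet T := by
    refine ((isOpen_Ioo.preimage continuous_snd).measurableSet).inter ?_
    exact ((isClosed_le continuous_const continuous_fst).inter
      (isClosed_le continuous_fst (hRc.comp continuous_snd))).measurableSet
  have hdm : Measurable (areaDensity m) := by unfold areaDensity; fun_prop
  have hdm' : Measurable fun p : ℝ × ℝ => ENNReal.ofReal (areaDensity m p.1) :=
    (hdm.comp measurable_fst).ennreal_ofReal
  -- Tonelli with the radius innermost: the slice of `T` at angle `θ` is the interval from `3 * m`
  -- to `R θ`.
  have hinner : ∀ θ : ℝ, (∫⁻ ρ : ℝ, T.indicator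
      (fun p : ℝ × ℝ => ENNReal.ofReal (areaDensity m p.1)) (ρ, θ)) =
      (Set.Ioo (-Real.pi) Real.pi).indicator
        (fun θ : ℝ => ENNReal.ofReal (sectorArea m (R θ))) θ := by
    intro θ
    by_cases hθ : θ ∈ Set.Ioo (-Real.pi) Real.pi
    · have : (fun ρ : ℝ => T.indicator
          (fun p : ℝ × ℝ => ENNReal.ofReal (areaDensity m p.1)) (ρ, θ)) =
          (Set.Icc (3 * m) (R θ)).indicator (fun ρ => ENNReal.ofReal (areaDensity m ρ)) := by
        ext ρ
        by_cases hρ : ρ ∈ Set.Icc (3 * m) (R θ)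
        · rw [Set.indicator_of_mem hρ, Set.indicator_of_mem (show (ρ, θ) ∈ T from ⟨hθ, hρ⟩)]
        · rw [Set.indicator_of_notMem hρ, Set.indicator_of_notMem fun h => hρ h.2]
      rw [this, MeasureTheory.lintegral_indicator measurableSet_Icc, Set.indicator_of_mem hθ,
        sectorArea, intervalIntegral.integral_of_le (hR3 _),
        ← MeasureTheory.integral_Icc_eq_integral_Ioc,
        MeasureTheory.ofReal_integral_eq_lintegral_ofReal]
      · exact (intervalIntegrable_iff_integrableOn_Icc_of_le (hR3 _)).1
          (intervalIntegrable_areaDensity hm le_rfl (hR3 _))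
      · exact Filter.Eventually.of_forall fun x => Real.sqrt_nonneg _
    · rw [Set.indicator_of_notMem hθ]
      have : (fun ρ : ℝ => T.indicator
          (fun p : ℝ × ℝ => ENNReal.ofReal (areaDensity m p.1)) (ρ, θ)) = fun _ => 0 := by
        ext ρ
        exact Set.indicator_of_notMem (fun h => hθ h.1) _
      rw [this, MeasureTheory.lintegral_zero]
  have hsc : Continuous fun θ : ℝ => sectorArea m (R θ) :=
    (continuousOn_sectorArea hm).comp_continuous hRc fun θ => hR3 θ
  rw [area, hset]
  simp only [sqrt_det_metric, Matrix.cons_val_zero]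
  rw [← MeasureTheory.lintegral_indicator hTm, MeasureTheory.Measure.volume_eq_prod,
    MeasureTheory.lintegral_prod_symm _
      (hdm'.indicator hTm).aemeasurable]
  simp only [hinner]
  rw [MeasureTheory.lintegral_indicator measurableSet_Ioo,
    intervalIntegral.integral_of_le (by linarith [Real.pi_pos]),
    MeasureTheory.integral_Ioc_eq_integral_Ioo,
    MeasureTheory.ofReal_integral_eq_lintegral_ofReal]
  · exact (hsc.integrableOn_Icc).mono_set Set.Ioo_subset_Icc_self
  · exact Filter.Eventually.of_forall fun x => sectorArea_nonneg hm (hR3 _)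

/-! ### Curves of monotone angle making one turn, and the area they bound. -/

/-- A strictly monotone angular coordinate of total variation `2π` takes each angle once, up to the
closing point. -/
lemma eq_or_endpoints_of_angle_eq {a b σ : ℝ} {φ : ℝ → ℝ} (hσ : σ = 1 ∨ σ = -1)
    (hmono : StrictMonoOn (fun t => σ * φ t) (Set.Icc a b)) (hw : φ b = φ a + 2 * Real.pi * σ)
    {s t : ℝ} (hs : s ∈ Set.Icc a b) (ht : t ∈ Set.Icc a b) (h : (φ s : Real.Angle) = φ t) :
    s = t ∨ (s = b ∧ t = a) ∨ (s = a ∧ t = b) := by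
  obtain ⟨k, hk⟩ := Real.Angle.angle_eq_iff_two_pi_dvd_sub.1 h
  have hab : a ≤ b := hs.1.trans hs.2
  have ha := Set.left_mem_Icc.2 hab
  have hb := Set.right_mem_Icc.2 hab
  have hσ2 : σ * σ = 1 := by rcases hσ with rfl | rfl <;> norm_num
  obtain ⟨l, hl⟩ : ∃ l : ℤ, σ * φ s - σ * φ t = 2 * Real.pi * l := by
    rcases hσ with rfl | rfl
    · exact ⟨k, by rw [← hk]; ring⟩
    · exact ⟨-k, by push_cast; linear_combination -hk⟩
  have hwσ : σ * φ b = σ * φ a + 2 * Real.pi := by rw [hw]; linear_combination 2 * Real.pi * hσ2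
  have hpi := Real.pi_pos
  have h1 := hmono.monotoneOn ha hs hs.1
  have h2 := hmono.monotoneOn hs hb hs.2
  have h3 := hmono.monotoneOn ha ht ht.1
  have h4 := hmono.monotoneOn ht hb ht.2
  -- The two angles differ by at most `2π`, so `l` is `-1`, `0` or `1`, and the extreme values occur
  -- only at the end points.
  rcases lt_trichotomy l 0 with hl0 | hl0 | hl0
  · have : (l : ℝ) ≤ -1 := by exact_mod_cast Int.le_sub_one_of_lt hl0
    right; right
    exact ⟨hmono.injOn hs ha (by nlinarith), hmono.injOn ht hb (by nlinarith)⟩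
  · left
    exact hmono.injOn hs ht (by rw [hl0] at hl; push_cast at hl; linarith)
  · have : (1 : ℝ) ≤ l := by exact_mod_cast hl0
    right; left
    exact ⟨hmono.injOn hs hb (by nlinarith), hmono.injOn ht ha (by nlinarith)⟩

/-- An angular coordinate of total variation `2π` takes every angle. -/
lemma exists_angle_eq {a b σ : ℝ} {φ : ℝ → ℝ} (hab : a ≤ b) (hσ : σ = 1 ∨ σ = -1)
    (hφ : ContinuousOn φ (Set.Icc a b)) (hw : φ b = φ a + 2 * Real.pi * σ) (θ : Real.Angle) :
    ∃ t ∈ Set.Icc a b, (φ t : Real.Angle) = θ := by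
  induction θ using Real.Angle.induction_on with
  | _ x =>
  have hp := Real.two_pi_pos
  -- The representative of the angle in the period starting at the smaller end value is attained by
  -- the intermediate value theorem.
  have hmem := toIcoMod_mem_Ico hp (min (φ a) (φ b)) x
  have hy : toIcoMod hp (min (φ a) (φ b)) x ∈ Set.uIcc (φ a) (φ b) := by
    refine ⟨hmem.1, hmem.2.le.trans ?_⟩
    rcases hσ with rfl | rfl
    · rw [min_eq_left (by linarith)]; exact le_trans (by linarith) le_sup_right
    · rw [min_eq_right (by linarith)]; exact le_trans (by linarith) le_sup_left
  rw [← Set.uIcc_of_le hab] at hφ ⊢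
  obtain ⟨t, ht, hte⟩ := intermediate_value_uIcc hφ hy
  refine ⟨t, ht, ?_⟩
  rw [hte, Real.Angle.angle_eq_iff_two_pi_dvd_sub]
  refine ⟨-toIcoDiv hp (min (φ a) (φ b)) x, ?_⟩
  rw [toIcoMod]
  push_cast
  simp only [zsmul_eq_mul]
  ring

/-- The area bounded by a closed polar graph, as an integral along the curve. -/
lemma area_boundedRegion {m a b σ : ℝ} (hm : 0 < m) (hab : a < b) {u : ℝ → Fin 2 → ℝ}
    (hu : ContinuousOn u (Set.Icc a b)) (hout : ∀ t ∈ Set.Icc a b, 3 * m ≤ u t 0)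
    (hcl : u b 0 = u a 0) (hσ : σ = 1 ∨ σ = -1) (hw : u b 1 = u a 1 + 2 * Real.pi * σ)
    (hmono : StrictMonoOn (fun t => σ * u t 1) (Set.Icc a b))
    {g : ℝ → ℝ} (hg : ContinuousOn g (Set.Icc a b))
    (hd : ∀ t ∈ Set.Ioo a b, HasDerivAt (fun t => u t 1) (σ * g t) t) :
    area m (boundedRegion m a b u) = ENNReal.ofReal (∫ t in a..b, sectorArea m (u t 0) * g t) := by
  have hu0 : ContinuousOn (fun t => u t 0) (Set.Icc a b) := (continuousOn_pi.1 hu) 0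
  have hu1 : ContinuousOn (fun t => u t 1) (Set.Icc a b) := (continuousOn_pi.1 hu) 1
  have hsurj := exists_angle_eq hab.le hσ hu1 hw
  obtain ⟨R, hRc, hR⟩ := exists_continuous_angle hu0 hu1 (fun s hs t ht h => by
    rcases eq_or_endpoints_of_angle_eq hσ hmono hw hs ht h with h | ⟨rfl, rfl⟩ | ⟨rfl, rfl⟩
    · rw [h]
    · exact hcl
    · exact hcl.symm) hsurj
  have hR3 : ∀ θ, 3 * m ≤ R θ := fun θ => by
    obtain ⟨t, ht, rfl⟩ := hsurj θ
    rw [hR t ht]; exact hout t ht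
  obtain ⟨M, hM⟩ := isCompact_Icc.exists_bound_of_continuousOn hu0
  have hRM : ∀ θ, R θ ≤ M := fun θ => by
    obtain ⟨t, ht, rfl⟩ := hsurj θ
    rw [hR t ht]; exact (le_abs_self _).trans (hM t ht)
  have hC : (fun t => toPlane (u t)) '' Set.Icc a b = {q | planeRadius q = R (planeAngle q)} := by
    ext q
    constructor
    · rintro ⟨t, ht, rfl⟩
      have h0 : 0 < u t 0 := by linarith [hout t ht]
      change planeRadius (toPlane (u t)) = _
      rw [planeRadius_toPlane h0.le, planeAngle_toPlane h0, hR t ht]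
    · intro hq
      obtain ⟨t, ht, hte⟩ := hsurj (planeAngle q)
      refine ⟨t, ht, toPlane_eq ?_ hte⟩
      rw [show planeRadius q = _ from hq, ← hte, hR t ht]
  have hregion : boundedRegion m a b u =
      {p | 3 * m ≤ planeRadius p ∧ planeRadius p ≤ R (planeAngle p)} := by
    ext p
    rw [boundedRegion, Set.mem_ofPred_eq,
      mem_jordanDomain_iff hRc (by linarith : 0 < 3 * m) hR3 hRM hC, and_comm]
    rfl
  rw [hregion, area_polar_region hm hRc hR3]
  congr 1
  have hsc : Continuous fun θ : ℝ => sectorArea m (R θ) :=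
    (continuousOn_sectorArea hm).comp_continuous (hRc.comp Real.Angle.continuous_coe)
      fun θ => hR3 θ
  have hper : Function.Periodic (fun θ : ℝ => sectorArea m (R θ)) (2 * Real.pi) := fun θ => by
    simp only [Real.Angle.coe_add, Real.Angle.coe_two_pi, add_zero]
  have hsub : ∫ t in a..b, sectorArea m (R (u t 1)) * (σ * g t) =
      ∫ θ in (u a 1)..(u b 1), sectorArea m (R θ) := by
    have hI : ContinuousOn (fun t => sectorArea m (R (u t 1)) * (σ * g t)) (Set.uIcc a b) := by
      rw [Set.uIcc_of_le hab.le]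
      exact (hsc.comp_continuousOn hu1).mul (continuousOn_const.mul hg)
    refine intervalIntegral.integral_comp_mul_deriv''' (f := fun t => u t 1)
      (g := fun θ : ℝ => sectorArea m (R θ)) ?_ ?_ hsc.continuousOn ?_ ?_
    · rwa [Set.uIcc_of_le hab.le]
    · intro x hx
      rw [min_eq_left hab.le, max_eq_right hab.le] at hx
      exact (hd x hx).hasDerivWithinAt
    · exact (hsc.continuousOn.integrableOn_compact
        (isCompact_uIcc.image_of_continuousOn (by rwa [Set.uIcc_of_le hab.le])))
    · exact hI.integrableOn_compact isCompact_uIcc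
  have hcongr : ∫ t in a..b, sectorArea m (R (u t 1)) * (σ * g t) =
      σ * ∫ t in a..b, sectorArea m (u t 0) * g t := by
    rw [← intervalIntegral.integral_const_mul]
    refine intervalIntegral.integral_congr fun t ht => ?_
    rw [Set.uIcc_of_le hab.le] at ht
    simp only [hR t ht]
    ring
  rw [hcongr, hw] at hsub
  have hp1 := hper.intervalIntegral_add_eq (-Real.pi) (u a 1)
  -- For `σ = -1` the angle decreases, so the period covered starts at `u a 1 - 2π`.
  have hp2 := hper.intervalIntegral_add_eq (-Real.pi) (u a 1 - 2 * Real.pi)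
  rw [show -Real.pi + 2 * Real.pi = Real.pi by ring] at hp1 hp2
  rcases hσ with rfl | rfl
  · rw [hp1]; rw [one_mul, mul_one] at hsub; exact hsub.symm
  · rw [hp2, intervalIntegral.integral_symm, sub_add_cancel]
    rw [show u a 1 + 2 * Real.pi * -1 = u a 1 - 2 * Real.pi by ring] at hsub
    linarith

/-! ### The circumference radius, and shrinking towards the photon sphere. -/

lemma invSqRadius_pos {m x : ℝ} (hm : 0 < m) (hx : 3 * m ≤ x) : 0 < invSqRadius m x := by
  have : 0 < x - 2 * m := by linarith
  have : 0 < x := by linarith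
  unfold invSqRadius; positivity

lemma continuousOn_invSqRadius {m : ℝ} (hm : 0 < m) :
    ContinuousOn (invSqRadius m) (Set.Ici (3 * m)) := by
  intro x hx
  have h : x ^ 3 ≠ 0 := pow_ne_zero 3 (by have : 3 * m ≤ x := hx; linarith)
  unfold invSqRadius
  exact ContinuousAt.continuousWithinAt (by fun_prop (disch := assumption))

lemma one_div_invSqRadius {m x : ℝ} (hx : x ≠ 0) :
    x ^ 2 / (1 - 2 * m / x) = 1 / invSqRadius m x := by
  rw [invSqRadius, show 1 - 2 * m / x = (x - 2 * m) / x by field_simp]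
  by_cases h : x - 2 * m = 0
  · simp [h]
  · field_simp

/-- The squared circumference radius is least on the photon sphere, because `x ^ 3 - 27 m ^ 2 (x -
2m) = (x - 3m) ^ 2 (x + 6m)`. -/
lemma invSqRadius_le {m x : ℝ} (hm : 0 < m) (hx : 3 * m ≤ x) :
    27 * m ^ 2 * invSqRadius m x ≤ 1 := by
  have : 0 < x := by linarith
  rw [invSqRadius, mul_div_assoc', div_le_one (by positivity)]
  nlinarith [mul_nonneg (sq_nonneg (x - 3 * m)) (by linarith : 0 ≤ x + 6 * m)]

lemma invSqRadius_lt {m x : ℝ} (hm : 0 < m) (hx : 3 * m < x) :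
    27 * m ^ 2 * invSqRadius m x < 1 := by
  have : 0 < x := by linarith
  rw [invSqRadius, mul_div_assoc', div_lt_one (by positivity)]
  nlinarith [mul_pos (pow_pos (sub_pos.2 hx) 2) (by linarith : 0 < x + 6 * m)]

/-- The radius moved towards the photon sphere by the factor `s`. -/
def shrink (m s x : ℝ) : ℝ := 3 * m + s * (x - 3 * m)

lemma le_shrink {m s x : ℝ} (hs : 0 ≤ s) (hx : 3 * m ≤ x) : 3 * m ≤ shrink m s x := by
  have := mul_nonneg hs (sub_nonneg.2 hx)
  unfold shrink; linarith

lemma shrink_le {m s x : ℝ} (hs : s ≤ 1) (hx : 3 * m ≤ x) : shrink m s x ≤ x := by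
  have := mul_nonneg (sub_nonneg.2 hs) (sub_nonneg.2 hx)
  unfold shrink; linarith

/-- Shrinking does not increase the radial speed. -/
lemma radial_shrink_le {m s x : ℝ} (hm : 0 < m) (hs : 0 ≤ s) (hs1 : s ≤ 1) (hx : 3 * m ≤ x) :
    1 / (1 - 2 * m / shrink m s x) ^ 2 * (s ^ 2 * (1 - 2 * m / x) ^ 2) ≤ 1 := by
  have hX := le_shrink hs hx
  have h1 : 0 < shrink m s x := by linarith
  have h2 : 0 < shrink m s x - 2 * m := by linarith
  have h3 : 0 < x := by linarith
  have h4 := one_sub_div_pos hm (by linarith : 2 * m < shrink m s x)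
  have h5 := one_sub_div_pos hm (by linarith : 2 * m < x)
  rw [one_div_mul_eq_div, div_le_one (by positivity), ← mul_pow]
  refine pow_le_pow_left₀ (by positivity) ?_ 2
  rw [show 1 - 2 * m / x = (x - 2 * m) / x by field_simp,
    show 1 - 2 * m / shrink m s x = (shrink m s x - 2 * m) / shrink m s x by field_simp,
    mul_div_assoc', div_le_div_iff₀ h3 h1]
  -- In the height `y` above the photon sphere, the difference of the two sides is `1 - s` times a
  -- polynomial with nonnegative coefficients.
  obtain ⟨y, hy, rfl⟩ : ∃ y, 0 ≤ y ∧ x = 3 * m + y := ⟨x - 3 * m, by linarith, by ring⟩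
  unfold shrink
  have e : (3 * m + s * (3 * m + y - 3 * m) - 2 * m) * (3 * m + y) -
      s * (3 * m + y - 2 * m) * (3 * m + s * (3 * m + y - 3 * m)) =
      (1 - s) * (3 * m ^ 2 + m * y + s * (m * y) + s * y ^ 2) := by ring
  have : 0 ≤ (1 - s) * (3 * m ^ 2 + m * y + s * (m * y) + s * y ^ 2) :=
    mul_nonneg (by linarith) (by positivity)
  linarith

/-- The squared circumference radius is convex along shrinking. -/
lemma angular_shrink_le {m s x : ℝ} (hm : 0 < m) (hs : 0 ≤ s) (hs1 : s ≤ 1) (hx : 3 * m ≤ x) :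
    1 / invSqRadius m (shrink m s x) ≤ s * (1 / invSqRadius m x) + (1 - s) * (27 * m ^ 2) := by
  obtain ⟨y, hy, rfl⟩ : ∃ y, 0 ≤ y ∧ x = 3 * m + y := ⟨x - 3 * m, by linarith, by ring⟩
  -- With the minimum `27 m ^ 2` split off, it remains to see that the excess at height `s * y` is
  -- at most `s` times the excess at `y`.
  have key : ∀ z, 0 ≤ z → 1 / invSqRadius m (3 * m + z) =
      27 * m ^ 2 + z ^ 2 * (9 * m + z) / (m + z) := fun z hz => by
    have h1 : m + z ≠ 0 := by positivity
    have h2 : 3 * m + z ≠ 0 := by positivity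
    rw [invSqRadius, show 3 * m + z - 2 * m = m + z by ring]
    field_simp
    ring
  have hsy : 0 ≤ s * y := by positivity
  rw [shrink, show 3 * m + s * (3 * m + y - 3 * m) = 3 * m + s * y by ring, key _ hsy, key _ hy]
  have : (s * y) ^ 2 * (9 * m + s * y) / (m + s * y) ≤ s * (y ^ 2 * (9 * m + y) / (m + y)) := by
    rw [mul_div_assoc', div_le_div_iff₀ (by positivity) (by positivity)]
    have e : s * (y ^ 2 * (9 * m + y)) * (m + s * y) - (s * y) ^ 2 * (9 * m + s * y) * (m + y) =
        s * y ^ 2 * (1 - s) * (9 * m ^ 2 + m * y + s * (m * y) + s * y ^ 2) := by ring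
    have : 0 ≤ s * y ^ 2 * (1 - s) * (9 * m ^ 2 + m * y + s * (m * y) + s * y ^ 2) :=
      mul_nonneg (mul_nonneg (by positivity) (by linarith)) (by positivity)
    linarith
  linarith

/-! ### Balancing the area between the two deformations. -/

/-- Redistributing the angle towards larger radii and shrinking can be balanced so that the area is
kept, with a redistribution cost that is of smaller order than the gain from shrinking. -/
lemma exists_area_preserving_shrink {m a b : ℝ} (hm : 0 < m) (hab : a < b) {r : ℝ → ℝ}
    (hr : Continuous r) (hr3 : ∀ t, 3 * m ≤ r t) {μ : ℝ}
    (hμ : ∫ t in a..b, invSqRadius m (r t) * (r t - μ) = 0)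
    (hne : ∃ t ∈ Set.Icc a b, r t ≠ μ) :
    ∃ δ s : ℝ, 0 ≤ s ∧ s ≤ 1 ∧ (∀ t ∈ Set.Icc a b, 1 / 2 ≤ 1 + δ * (r t - μ)) ∧
      ∫ t in a..b, sectorArea m (shrink m s (r t)) *
        (invSqRadius m (r t) * (1 + δ * (r t - μ))) =
        ∫ t in a..b, sectorArea m (r t) * invSqRadius m (r t) ∧
      δ ^ 2 * (∫ t in a..b, invSqRadius m (r t) * (r t - μ) ^ 2) <
        (1 - s) / 4 * ∫ t in a..b, invSqRadius m (r t) * (1 - 27 * m ^ 2 * invSqRadius m (r t)) := by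
  set q : ℝ → ℝ := fun t => invSqRadius m (r t) with hq
  have hqc : Continuous q := (continuousOn_invSqRadius hm).comp_continuous hr hr3
  have hq0 : ∀ t, 0 < q t := fun t => invSqRadius_pos hm (hr3 t)
  have hii : ∀ f : ℝ → ℝ, Continuous f → IntervalIntegrable f MeasureTheory.volume a b :=
    fun f hf => hf.intervalIntegrable _ _
  have hqI : 0 < ∫ t in a..b, q t :=
    intervalIntegral.intervalIntegral_pos_of_pos (hii q hqc) hq0 hab
  -- A weighted mean of radii is at least `3 * m`, so `sectorArea` may be compared monotonically at
  -- `μ`.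
  have hμ3 : 3 * m ≤ μ := by
    by_contra hlt
    push Not at hlt
    have : 0 < ∫ t in a..b, q t * (r t - μ) :=
      intervalIntegral.intervalIntegral_pos_of_pos (hii _ (by fun_prop))
        (fun t => mul_pos (hq0 t) (by linarith [hr3 t])) hab
    exact this.ne' hμ
  obtain ⟨t₀, ht₀, hne⟩ := hne
  -- some radius exceeds `3 * m`
  have hex : ∃ t ∈ Set.Icc a b, 3 * m < r t := by
    by_contra hcon
    push Not at hcon
    have h3 : ∀ t ∈ Set.Icc a b, r t = 3 * m := fun t ht => le_antisymm (hcon t ht) (hr3 t)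
    have : ∫ t in a..b, q t * (r t - μ) = ∫ t in a..b, q t * (3 * m - μ) :=
      intervalIntegral.integral_congr fun t ht => by
        rw [Set.uIcc_of_le hab.le] at ht; simp only [h3 t ht]
    rw [hμ, intervalIntegral.integral_mul_const] at this
    rcases mul_eq_zero.1 this.symm with h | h
    · exact hqI.ne' h
    · exact hne (by rw [h3 t₀ ht₀]; linarith)
  obtain ⟨M, hM⟩ := isCompact_Icc.exists_bound_of_continuousOn (hr.continuousOn (s := Set.Icc a b))
  have hrM : ∀ t ∈ Set.Icc a b, r t ≤ M := fun t ht => (le_abs_self _).trans (hM t ht)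
  obtain ⟨C, hC0, hC⟩ := exists_sectorArea_lipschitz hm M
  have hHc : ∀ s, 0 ≤ s → Continuous fun t => sectorArea m (shrink m s (r t)) := fun s hs =>
    (continuousOn_sectorArea hm).comp_continuous (by unfold shrink; fun_prop)
      fun t => le_shrink hs (hr3 t)
  have hH1 : Continuous fun t => sectorArea m (r t) :=
    (continuousOn_sectorArea hm).comp_continuous hr hr3
  -- Up to constants: `K₁` is the cost of redistribution, `K₂` the gain from shrinking, `K₃` bounds
  -- the area lost by shrinking, and `B` is the rate of area gained by redistribution.
  set K₁ := ∫ t in a..b, q t * (r t - μ) ^ 2 with hK₁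
  set K₂ := ∫ t in a..b, q t * (1 - 27 * m ^ 2 * q t) with hK₂
  set K₃ := ∫ t in a..b, q t * (r t - 3 * m) with hK₃
  set B := ∫ t in a..b, sectorArea m (r t) * (q t * (r t - μ)) with hB
  have hK₁0 : 0 ≤ K₁ := intervalIntegral.integral_nonneg hab.le fun t _ =>
    mul_nonneg (hq0 t).le (sq_nonneg _)
  have hK₂0 : 0 < K₂ := by
    obtain ⟨t, ht, h⟩ := hex
    refine intervalIntegral.integral_pos hab (by fun_prop) (fun t _ => ?_) ⟨t, ht, ?_⟩
    · exact mul_nonneg (hq0 t).le (sub_nonneg.2 (invSqRadius_le hm (hr3 t)))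
    · exact mul_pos (hq0 t) (sub_pos.2 (invSqRadius_lt hm h))
  have hK₃0 : 0 < K₃ := by
    obtain ⟨t, ht, h⟩ := hex
    refine intervalIntegral.integral_pos hab (by fun_prop) (fun t _ => ?_) ⟨t, ht, ?_⟩
    · exact mul_nonneg (hq0 t).le (sub_nonneg.2 (hr3 t))
    · exact mul_pos (hq0 t) (sub_pos.2 h)
  -- Chebyshev's argument: by `hμ` the constant `sectorArea m μ` can be subtracted for free, after
  -- which both factors have the sign of `r t - μ`.
  have hB0 : 0 < B := by
    have h1 : B = ∫ t in a..b, (sectorArea m (r t) - sectorArea m μ) * (q t * (r t - μ)) := by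
      simp only [sub_mul]
      rw [intervalIntegral.integral_sub (hii _ (by fun_prop)) (hii _ (by fun_prop)),
        intervalIntegral.integral_const_mul, hμ, mul_zero, sub_zero]
    rw [h1]
    have hpos : ∀ t, r t ≠ μ →
        0 < (sectorArea m (r t) - sectorArea m μ) * (q t * (r t - μ)) := fun t ht => by
      rcases lt_or_gt_of_ne ht with h | h
      · exact mul_pos_of_neg_of_neg (sub_neg.2 (sectorArea_strictMonoOn hm (hr3 t) hμ3 h))
          (mul_neg_of_pos_of_neg (hq0 t) (sub_neg.2 h))
      · exact mul_pos (sub_pos.2 (sectorArea_strictMonoOn hm hμ3 (hr3 t) h))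
          (mul_pos (hq0 t) (sub_pos.2 h))
    refine intervalIntegral.integral_pos hab (by fun_prop) (fun t _ => ?_) ⟨t₀, ht₀, hpos _ hne⟩
    by_cases h : r t = μ
    · simp [h]
    · exact (hpos t h).le
  obtain ⟨N, hN⟩ := isCompact_Icc.exists_bound_of_continuousOn
    ((hr.sub continuous_const).continuousOn (s := Set.Icc a b) (f := fun t => r t - μ))
  -- The first bound keeps the angular factor between `1 / 2` and `2`; the second makes the
  -- quadratic cost smaller than the linear gain. The `+ 1` in each denominator of the witness
  -- guards against `N` or `K₁` being zero.
  obtain ⟨δ, hδ0, hδN, hδK⟩ : ∃ δ : ℝ, 0 < δ ∧ δ * (|N| + 1) ≤ 1 / 2 ∧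
      δ * (4 * (2 * C * K₃) * K₁) < B * K₂ := by
    refine ⟨min (1 / 2 / (|N| + 1)) (B * K₂ / (4 * (2 * C * K₃) * K₁ + 1)), ?_, ?_, ?_⟩
    · exact lt_min (by positivity) (by positivity)
    · calc _ ≤ 1 / 2 / (|N| + 1) * (|N| + 1) := by gcongr; exact min_le_left _ _
        _ = 1 / 2 := by field_simp
    · calc _ ≤ B * K₂ / (4 * (2 * C * K₃) * K₁ + 1) * (4 * (2 * C * K₃) * K₁) := by
            gcongr; exact min_le_right _ _
        _ < B * K₂ / (4 * (2 * C * K₃) * K₁ + 1) * (4 * (2 * C * K₃) * K₁ + 1) := by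
            gcongr; linarith
        _ = B * K₂ := by field_simp
  have hψ : ∀ t ∈ Set.Icc a b, |δ * (r t - μ)| ≤ 1 / 2 := fun t ht => by
    rw [abs_mul, abs_of_pos hδ0]
    refine le_trans (mul_le_mul_of_nonneg_left ?_ hδ0.le) hδN
    exact (hN t ht).trans ((le_abs_self N).trans (by linarith))
  have hlow : ∀ t ∈ Set.Icc a b, 1 / 2 ≤ 1 + δ * (r t - μ) := fun t ht => by
    linarith [(abs_le.1 (hψ t ht)).1]
  have hup : ∀ t ∈ Set.Icc a b, 1 + δ * (r t - μ) ≤ 2 := fun t ht => by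
    linarith [(abs_le.1 (hψ t ht)).2]
  set 𝒜 : ℝ → ℝ := fun s => ∫ t in a..b, sectorArea m (shrink m s (r t)) *
    (q t * (1 + δ * (r t - μ))) with h𝒜
  have hIc : ∀ s, 0 ≤ s → Continuous fun t => sectorArea m (shrink m s (r t)) *
    (q t * (1 + δ * (r t - μ))) := fun s hs => (hHc s hs).mul (by fun_prop)
  have hlip : ∀ s ∈ Set.Icc (0 : ℝ) 1, ∀ s' ∈ Set.Icc (0 : ℝ) 1,
      𝒜 s' - 𝒜 s ≤ 2 * C * K₃ * |s' - s| := by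
    intro s hs s' hs'
    rw [h𝒜]
    simp only
    rw [← intervalIntegral.integral_sub (hii _ (hIc s' hs'.1)) (hii _ (hIc s hs.1)),
      show 2 * C * K₃ * |s' - s| = (2 * C * |s' - s|) * K₃ by ring, hK₃,
      ← intervalIntegral.integral_const_mul]
    refine intervalIntegral.integral_mono_on hab.le
      ((hii _ (hIc s' hs'.1)).sub (hii _ (hIc s hs.1))) (hii _ (by fun_prop)) fun t ht => ?_
    have h1 := hC _ ⟨le_shrink hs.1 (hr3 t), (shrink_le hs.2 (hr3 t)).trans (hrM t ht)⟩
      _ ⟨le_shrink hs'.1 (hr3 t), (shrink_le hs'.2 (hr3 t)).trans (hrM t ht)⟩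
    have h2 : |shrink m s' (r t) - shrink m s (r t)| = |s' - s| * (r t - 3 * m) := by
      rw [show shrink m s' (r t) - shrink m s (r t) = (s' - s) * (r t - 3 * m) by
        unfold shrink; ring, abs_mul, abs_of_nonneg (sub_nonneg.2 (hr3 t))]
    rw [h2] at h1
    have h3 := (le_abs_self _).trans h1
    have h4 := hlow t ht
    have h5 := hup t ht
    have h6 := hr3 t
    have h7 : 0 ≤ C * (|s' - s| * (r t - 3 * m)) := le_trans (abs_nonneg _) h1
    rw [← sub_mul]
    calc _ ≤ C * (|s' - s| * (r t - 3 * m)) * (q t * 2) := by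
          apply mul_le_mul h3 _ _ h7
          · exact mul_le_mul_of_nonneg_left h5 (hq0 t).le
          · exact mul_nonneg (hq0 t).le (by linarith)
      _ = _ := by ring
  have hcont : ContinuousOn 𝒜 (Set.Icc 0 1) := by
    refine LipschitzOnWith.continuousOn (K := (2 * C * K₃).toNNReal)
      (LipschitzOnWith.of_dist_le_mul fun s' hs' s hs => ?_)
    rw [Real.coe_toNNReal _ (by positivity), Real.dist_eq, Real.dist_eq, abs_le]
    have h1 := hlip s hs s' hs'
    have h2 := hlip s' hs' s hs
    rw [abs_sub_comm] at h2
    exact ⟨by linarith, h1⟩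
  have h𝒜0 : 𝒜 0 = 0 := by
    rw [h𝒜]
    simp [shrink, sectorArea]
  have h𝒜1 : 𝒜 1 = (∫ t in a..b, sectorArea m (r t) * q t) + δ * B := by
    rw [h𝒜, hB, ← intervalIntegral.integral_const_mul,
      ← intervalIntegral.integral_add (hii _ (by fun_prop)) (hii _ (by fun_prop))]
    refine intervalIntegral.integral_congr fun t _ => ?_
    simp only [shrink]
    rw [show 3 * m + 1 * (r t - 3 * m) = r t by ring]
    ring
  have hA0 : 0 ≤ ∫ t in a..b, sectorArea m (r t) * q t :=
    intervalIntegral.integral_nonneg hab.le fun t _ =>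
      mul_nonneg (sectorArea_nonneg hm (hr3 t)) (hq0 t).le
  -- At `s = 0` the area is zero; at `s = 1` it exceeds the target by `δ * B`.
  obtain ⟨s, hs, hsA⟩ := intermediate_value_Icc zero_le_one hcont
    (show (∫ t in a..b, sectorArea m (r t) * q t) ∈ Set.Icc (𝒜 0) (𝒜 1) by
      rw [h𝒜0, h𝒜1]; exact ⟨hA0, by linarith [mul_pos hδ0 hB0]⟩)
  refine ⟨δ, s, hs.1, hs.2, hlow, hsA, ?_⟩
  -- The Lipschitz bound between `s` and `1` shows that removing the surplus `δ * B` forces `1 - s`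
  -- to be of order at least `δ`.
  have h1 := hlip s hs 1 ⟨zero_le_one, le_rfl⟩
  rw [h𝒜1, hsA, abs_of_nonneg (sub_nonneg.2 hs.2)] at h1
  have hCK : 0 < 2 * C * K₃ := by positivity
  have h2 : δ * B ≤ 2 * C * K₃ * (1 - s) := by linarith
  have h3 : δ * (δ * (4 * (2 * C * K₃) * K₁)) < δ * (B * K₂) := mul_lt_mul_of_pos_left hδK hδ0
  have h4 : δ * B * K₂ ≤ 2 * C * K₃ * (1 - s) * K₂ := mul_le_mul_of_nonneg_right h2 hK₂0.le
  have h5 : (2 * C * K₃) * (4 * (δ ^ 2 * K₁)) < (2 * C * K₃) * ((1 - s) * K₂) := by nlinarith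
  have := lt_of_mul_lt_mul_left h5 hCK.le
  linarith

/-! ### Piecewise smoothness, length and energy. -/

lemma monotone_subdivision {n : ℕ} {t : ℕ → ℝ} (ht : ∀ i < n, t i < t (i + 1)) {i j : ℕ}
    (hij : i ≤ j) (hj : j ≤ n) : t i ≤ t j := by
  induction j, hij using Nat.le_induction with
  | base => exact le_rfl
  | succ k _ ih => exact (ih (by omega)).trans (ht k (by omega)).le

lemma PiecewiseSmoothOn.continuousOn {u : ℝ → Fin 2 → ℝ} {a b : ℝ}
    (h : PiecewiseSmoothOn u a b) : ContinuousOn u (Set.Icc a b) := by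
  obtain ⟨n, t, rfl, rfl, ht⟩ := h
  have : ∀ k ≤ n, ContinuousOn u (Set.Icc (t 0) (t k)) := by
    intro k
    induction k with
    | zero => intro _; rw [Set.Icc_self]; exact continuousOn_singleton _ _
    | succ k ih =>
      intro hk
      rw [← Set.Icc_union_Icc_eq_Icc (b := t k)
        (monotone_subdivision (fun i hi => (ht i hi).1) (Nat.zero_le k) (by omega))
        (ht k (by omega)).1.le]
      exact (ih (by omega)).union_of_isClosed (ht k (by omega)).2.continuousOn isClosed_Icc
        isClosed_Icc
  exact this n le_rfl

/-- The antiderivative of a continuous function is smooth wherever the function is. -/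
lemma contDiffOn_antiderivative {g : ℝ → ℝ} (hg : Continuous g) (a : ℝ) {c d : ℝ} (hcd : c < d)
    (hs : ContDiffOn ℝ ∞ g (Set.Icc c d)) :
    ContDiffOn ℝ ∞ (fun t => ∫ x in a..t, g x) (Set.Icc c d) := by
  have hd : ∀ t, HasDerivAt (fun t => ∫ x in a..t, g x) (g t) t := fun t =>
    intervalIntegral.integral_hasDerivAt_right (hg.intervalIntegrable _ _)
      (hg.stronglyMeasurableAtFilter _ _) hg.continuousAt
  rw [contDiffOn_infty_iff_derivWithin (uniqueDiffOn_Icc hcd)]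
  refine ⟨fun t _ => (hd t).differentiableAt.differentiableWithinAt, hs.congr fun t ht => ?_⟩
  exact (hd t).hasDerivWithinAt.derivWithin (uniqueDiffOn_Icc hcd t ht)

/-- The length of a curve that is differentiable between its end points. -/
lemma length_eq_of_hasDerivAt {m a b : ℝ} (hab : a ≤ b) {u : ℝ → Fin 2 → ℝ} {d₀ d₁ F : ℝ → ℝ}
    (h₀ : ∀ t ∈ Set.Ioo a b, HasDerivAt (fun t => u t 0) (d₀ t) t)
    (h₁ : ∀ t ∈ Set.Ioo a b, HasDerivAt (fun t => u t 1) (d₁ t) t)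
    (hF : ∀ t ∈ Set.Ioo a b, 1 / (1 - 2 * m / u t 0) ^ 2 * d₀ t ^ 2 +
      u t 0 ^ 2 / (1 - 2 * m / u t 0) * d₁ t ^ 2 = F t) :
    length m a b u = ∫ t in a..b, Real.sqrt (F t) := by
  rw [length]
  -- The end points, where `deriv u` need not be the velocity, form a null set and are dropped.
  simp only [intervalIntegral.integral_of_le hab, MeasureTheory.integral_Ioc_eq_integral_Ioo]
  refine MeasureTheory.setIntegral_congr_fun measurableSet_Ioo fun t ht => ?_
  have hd : HasDerivAt u ![d₀ t, d₁ t] t := by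
    rw [hasDerivAt_pi]
    intro i
    fin_cases i
    · exact h₀ t ht
    · exact h₁ t ht
  simp only [hd.deriv, ← hF t ht, Fin.sum_univ_two, metric]
  simp [sq, mul_assoc]

/-- Cauchy–Schwarz comparison of length and energy. -/
lemma integral_sqrt_lt {a b E : ℝ} (hab : a < b) (hE : 0 < E) {G : ℝ → ℝ} (hG : Continuous G)
    (hG0 : ∀ t ∈ Set.Ioo a b, 0 ≤ G t) (h : ∫ t in a..b, G t < E * (b - a)) :
    ∫ t in a..b, Real.sqrt (G t) < Real.sqrt E * (b - a) := by
  have hE' := Real.sqrt_pos.2 hE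
  have hEE := Real.mul_self_sqrt hE.le
  -- Pointwise `2 √E √G ≤ G + E`.
  have h1 : ∫ t in a..b, Real.sqrt (G t) ≤
      ∫ t in a..b, (2 * Real.sqrt E)⁻¹ * (G t + E) := by
    refine intervalIntegral.integral_mono_on_of_le_Ioo hab.le
      (Continuous.intervalIntegrable (by fun_prop) _ _)
      (Continuous.intervalIntegrable (by fun_prop) _ _) fun t ht => ?_
    have h2 := Real.mul_self_sqrt (hG0 t ht)
    rw [inv_mul_eq_div, le_div_iff₀ (by positivity)]
    nlinarith [sq_nonneg (Real.sqrt (G t) - Real.sqrt E)]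
  refine h1.trans_lt ?_
  rw [intervalIntegral.integral_const_mul, intervalIntegral.integral_add
    (hG.intervalIntegrable _ _) (Continuous.intervalIntegrable (by fun_prop) _ _),
    intervalIntegral.integral_const, smul_eq_mul, inv_mul_lt_iff₀ (by positivity)]
  calc _ < E * (b - a) + (b - a) * E := by linarith
    _ = _ := by linear_combination (-2 * (b - a)) * hEE

/-! ### The shorter competitor. -/

/-- A light ray of non-constant radius that closes up around the photon sphere is not a shortest
curve for the area that it bounds. -/
lemma IsLightRayOn.exists_shorter {m a b J E σ μ : ℝ} (hm : 0 < m) {γ : ℝ → Fin 2 → ℝ}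
    (hadm : IsAdmissible m a b γ) (hray : IsLightRayOn m γ (Set.Ioo a b))
    (hcons : ∀ t ∈ Set.Ioo a b, deriv γ t 1 = J * invSqRadius m (γ t 0) ∧
      deriv γ t 0 ^ 2 = (1 - 2 * m / γ t 0) ^ 2 * (E - J ^ 2 * invSqRadius m (γ t 0)))
    (hσ : σ = 1 ∨ σ = -1) (hw : γ b 1 = γ a 1 + 2 * Real.pi * σ) {r : ℝ → ℝ} (hr : Continuous r)
    (hr3 : ∀ t, 3 * m ≤ r t) (hrγ : ∀ t ∈ Set.Icc a b, γ t 0 = r t)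
    (hJ : J * ∫ t in a..b, invSqRadius m (r t) = 2 * Real.pi * σ)
    (hμ : ∫ t in a..b, invSqRadius m (r t) * (r t - μ) = 0)
    (hne : ∃ t ∈ Set.Icc a b, r t ≠ μ) :
    ∃ v : ℝ → Fin 2 → ℝ, IsAdmissible m a b v ∧
      area m (boundedRegion m a b v) = area m (boundedRegion m a b γ) ∧
      length m a b v < length m a b γ := by
  have hab := hadm.lt
  have hγc := hadm.piecewiseSmooth.continuousOn
  have hσ2 : σ * σ = 1 := by rcases hσ with rfl | rfl <;> norm_num
  have hii : ∀ f : ℝ → ℝ, Continuous f → IntervalIntegrable f MeasureTheory.volume a b :=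
    fun f hf => hf.intervalIntegrable _ _
  obtain ⟨δ, s, hs0, hs1, hψ, harea, hgain⟩ :=
    exists_area_preserving_shrink hm hab hr hr3 hμ hne
  set q : ℝ → ℝ := fun t => invSqRadius m (r t) with hq
  have hqc : Continuous q := (continuousOn_invSqRadius hm).comp_continuous hr hr3
  have hq0 : ∀ t, 0 < q t := fun t => invSqRadius_pos hm (hr3 t)
  have hqI : 0 < ∫ t in a..b, q t :=
    intervalIntegral.intervalIntegral_pos_of_pos (hii q hqc) hq0 hab
  -- The sign of the angular momentum is the orientation `σ`.
  obtain ⟨j, hj0, rfl⟩ : ∃ j, 0 < j ∧ J = σ * j := by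
    refine ⟨σ * J, ?_, by linear_combination (-J) * hσ2⟩
    refine pos_of_mul_pos_left (b := ∫ t in a..b, q t) ?_ hqI.le
    have : σ * J * (∫ t in a..b, q t) = 2 * Real.pi := by
      linear_combination σ * hJ + 2 * Real.pi * hσ2
    rw [this]; exact Real.two_pi_pos
  have hJ2 : (σ * j) ^ 2 = j ^ 2 := by linear_combination j ^ 2 * hσ2
  -- The unsigned angular speed `j * q` of the ray times a factor of `q`-weighted mean one, so that
  -- the total angle is still `2π`.
  set g : ℝ → ℝ := fun t => j * (q t * (1 + δ * (r t - μ))) with hg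
  have hgc : Continuous g := by fun_prop
  have hg0 : ∀ t ∈ Set.Icc a b, 0 < g t := fun t ht =>
    mul_pos hj0 (mul_pos (hq0 t) (by linarith [hψ t ht]))
  have hgI : ∫ t in a..b, σ * g t = 2 * Real.pi * σ := by
    have : ∀ t, σ * g t = σ * j * q t + σ * j * δ * (q t * (r t - μ)) := fun t => by
      simp only [hg]; ring
    simp only [this]
    rw [intervalIntegral.integral_add (hii _ (by fun_prop)) (hii _ (by fun_prop)),
      intervalIntegral.integral_const_mul, intervalIntegral.integral_const_mul, hμ, hJ]
    ring
  -- the competitor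
  set v : ℝ → Fin 2 → ℝ := fun t =>
    ![shrink m s (r t), γ a 1 + ∫ x in a..t, σ * g x] with hv
  have hv1d : ∀ t, HasDerivAt (fun t => v t 1) (σ * g t) t := fun t =>
    (intervalIntegral.integral_hasDerivAt_right
      (Continuous.intervalIntegrable (by fun_prop) _ _)
      (Continuous.stronglyMeasurableAtFilter (by fun_prop) _ _)
      (Continuous.continuousAt (by fun_prop))).const_add (γ a 1)
  have hv0 : ∀ t, v t 0 = shrink m s (r t) := fun t => rfl
  have hvc : Continuous v := continuous_pi fun i => by
    fin_cases i
    · change Continuous fun t => shrink m s (r t)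
      unfold shrink; fun_prop
    · exact continuous_iff_continuousAt.2 fun t => (hv1d t).continuousAt
  have hvw : v b 1 = v a 1 + 2 * Real.pi * σ := by
    change γ a 1 + (∫ x in a..b, σ * g x) = γ a 1 + (∫ x in a..a, σ * g x) + 2 * Real.pi * σ
    rw [hgI, intervalIntegral.integral_same, add_zero]
  have hvmono : StrictMonoOn (fun t => σ * v t 1) (Set.Icc a b) := by
    refine strictMonoOn_of_deriv_pos (convex_Icc a b) ?_ fun t ht => ?_
    · exact (continuous_const.mul ((continuous_apply 1).comp hvc)).continuousOn
    · rw [interior_Icc] at ht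
      rw [((hv1d t).const_mul σ).deriv, ← mul_assoc, hσ2, one_mul]
      exact hg0 t (Set.Ioo_subset_Icc_self ht)
  have hrab : r b = r a := by
    rw [← hrγ b (Set.right_mem_Icc.2 hab.le), ← hrγ a (Set.left_mem_Icc.2 hab.le), hadm.closed]
  have hvout : ∀ t ∈ Set.Icc a b, 3 * m ≤ v t 0 := fun t _ => le_shrink hs0 (hr3 t)
  have hvcl : v b 0 = v a 0 := by rw [hv0, hv0, hrab]
  have hγ1d : ∀ t ∈ Set.Ioo a b, HasDerivAt (fun t => γ t 1) (σ * (j * q t)) t := fun t ht => by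
    have := (hray.hasDerivAt isOpen_Ioo ht 1).1
    rw [(hcons t ht).1, hrγ t (Set.Ioo_subset_Icc_self ht), mul_assoc] at this
    exact this
  have hγ0d : ∀ t ∈ Set.Ioo a b, HasDerivAt r (deriv γ t 0) t := fun t ht => by
    refine (hray.hasDerivAt isOpen_Ioo ht 0).1.congr_of_eventuallyEq ?_
    filter_upwards [Icc_mem_nhds ht.1 ht.2] with x hx using (hrγ x hx).symm
  have hγmono : StrictMonoOn (fun t => σ * γ t 1) (Set.Icc a b) := by
    refine strictMonoOn_of_deriv_pos (convex_Icc a b) ?_ fun t ht => ?_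
    · exact continuousOn_const.mul ((continuousOn_pi.1 hγc) 1)
    · rw [interior_Icc] at ht
      rw [((hγ1d t ht).const_mul σ).deriv, ← mul_assoc, hσ2, one_mul]
      exact mul_pos hj0 (hq0 t)
  refine ⟨v, ⟨hab, ?_, hvout, hvcl, ?_, ?_⟩, ?_, ?_⟩
  · obtain ⟨n, t, h0, hn, ht⟩ := hadm.piecewiseSmooth
    refine ⟨n, t, h0, hn, fun i hi => ⟨(ht i hi).1, ?_⟩⟩
    have hsub : Set.Icc (t i) (t (i + 1)) ⊆ Set.Icc a b := by
      rw [← h0, ← hn]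
      exact Set.Icc_subset_Icc
        (monotone_subdivision (fun i hi => (ht i hi).1) (Nat.zero_le i) (by omega))
        (monotone_subdivision (fun i hi => (ht i hi).1) (by omega : i + 1 ≤ n) le_rfl)
    have hrs : ContDiffOn ℝ ∞ r (Set.Icc (t i) (t (i + 1))) :=
      ((contDiffOn_pi.1 (ht i hi).2) 0).congr fun x hx => (hrγ x (hsub hx)).symm
    rw [contDiffOn_pi]
    intro k
    fin_cases k
    · change ContDiffOn ℝ ∞ (fun t => shrink m s (r t)) _
      unfold shrink
      fun_prop
    · change ContDiffOn ℝ ∞ (fun t => γ a 1 + ∫ x in a..t, σ * g x) _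
      refine contDiffOn_const.add (contDiffOn_antiderivative (by fun_prop) a (ht i hi).1 ?_)
      have hqs : ContDiffOn ℝ ∞ q (Set.Icc (t i) (t (i + 1))) := by
        simp only [hq, invSqRadius]
        exact (hrs.sub contDiffOn_const).div (hrs.pow 3) fun x _ =>
          pow_ne_zero 3 (by linarith [hr3 x])
      simp only [hg]
      fun_prop
  · rcases hσ with rfl | rfl
    · left; rw [hvw]; ring
    · right; rw [hvw]; ring
  · intro x hx y hy hxy
    have hx0 : 0 < v x 0 := by linarith [hvout x (Set.Ico_subset_Icc_self hx)]
    have hy0 : 0 < v y 0 := by linarith [hvout y (Set.Ico_subset_Icc_self hy)]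
    have h := congrArg planeAngle hxy
    simp only [planeAngle_toPlane hx0, planeAngle_toPlane hy0] at h
    rcases eq_or_endpoints_of_angle_eq hσ hvmono hvw (Set.Ico_subset_Icc_self hx)
      (Set.Ico_subset_Icc_self hy) h with h | ⟨h, -⟩ | ⟨-, h⟩
    · exact h
    · exact absurd h hx.2.ne
    · exact absurd h hy.2.ne
  · rw [area_boundedRegion hm hab hvc.continuousOn hvout hvcl hσ hvw hvmono hgc.continuousOn
        (fun t _ => hv1d t),
      area_boundedRegion hm hab hγc hadm.outside hadm.closed hσ hw hγmono
        (g := fun t => j * q t) (by fun_prop) hγ1d]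
    congr 1
    have e1 : ∫ t in a..b, sectorArea m (v t 0) * g t =
        j * ∫ t in a..b, sectorArea m (shrink m s (r t)) * (q t * (1 + δ * (r t - μ))) := by
      rw [← intervalIntegral.integral_const_mul]
      refine intervalIntegral.integral_congr fun t _ => ?_
      simp only [hv0, hg]; ring
    have e2 : ∫ t in a..b, sectorArea m (γ t 0) * (j * q t) =
        j * ∫ t in a..b, sectorArea m (r t) * q t := by
      rw [← intervalIntegral.integral_const_mul]
      refine intervalIntegral.integral_congr fun t ht => ?_
      rw [Set.uIcc_of_le hab.le] at ht
      simp only [hrγ t ht]; ring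
    rw [e1, e2, harea]
  · have hkin : ∀ t ∈ Set.Ioo a b, 0 ≤ E - j ^ 2 * q t := fun t ht => by
      have h := (hcons t ht).2
      rw [hrγ t (Set.Ioo_subset_Icc_self ht), hJ2] at h
      have hf := one_sub_div_pos hm (by linarith [hr3 t] : 2 * m < r t)
      refine nonneg_of_mul_nonneg_right (b := E - j ^ 2 * q t) (a := (1 - 2 * m / r t) ^ 2) ?_
        (by positivity)
      rw [← h]; positivity
    have hE : 0 < E := by
      have := hkin ((a + b) / 2) ⟨by linarith, by linarith⟩
      have h2 := mul_pos (pow_pos hj0 2) (hq0 ((a + b) / 2))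
      linarith
    -- By conservation of energy the ray has constant speed `√E`.
    have hlγ : length m a b γ = Real.sqrt E * (b - a) := by
      rw [length_eq_of_hasDerivAt hab.le (F := fun _ => E)
        (fun t ht => (hray.hasDerivAt isOpen_Ioo ht 0).1) hγ1d]
      · simp [mul_comm]
      · intro t ht
        have h2 := hcons t ht
        rw [h2.2, hrγ t (Set.Ioo_subset_Icc_self ht), hJ2,
          one_div_invSqRadius (by linarith [hr3 t])]
        have hf := (one_sub_div_pos hm (by linarith [hr3 t] : 2 * m < r t)).ne'
        have hq' := (hq0 t).ne'
        change _ * (_ * (E - j ^ 2 * q t)) + 1 / q t * _ = E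
        rw [mul_pow, ← mul_assoc, one_div_mul_cancel (pow_ne_zero 2 hf)]
        rw [show σ ^ 2 = 1 by rw [sq, hσ2]]
        field_simp
        ring
    -- The squared speed of the competitor, with the squared radial velocity of the ray eliminated
    -- by the conservation law; in this form it is continuous up to the end points and beyond.
    set G : ℝ → ℝ := fun t => 1 / (1 - 2 * m / shrink m s (r t)) ^ 2 *
      (s ^ 2 * (1 - 2 * m / r t) ^ 2) * (E - j ^ 2 * q t) +
      1 / invSqRadius m (shrink m s (r t)) * g t ^ 2 with hGdef
    have hRc : Continuous fun t => shrink m s (r t) := by unfold shrink; fun_prop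
    have hGc : Continuous G := by
      have hR3 : ∀ t, 3 * m ≤ shrink m s (r t) := fun t => le_shrink hs0 (hr3 t)
      have h1 : ∀ t, shrink m s (r t) ≠ 0 := fun t => by linarith [hR3 t]
      have h2 : ∀ t, r t ≠ 0 := fun t => by linarith [hr3 t]
      have h3 : ∀ t, (1 - 2 * m / shrink m s (r t)) ^ 2 ≠ 0 := fun t =>
        pow_ne_zero 2 (one_sub_div_pos hm (by linarith [hR3 t])).ne'
      have h4 : Continuous fun t => invSqRadius m (shrink m s (r t)) :=
        (continuousOn_invSqRadius hm).comp_continuous hRc hR3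
      have h5 : ∀ t, invSqRadius m (shrink m s (r t)) ≠ 0 := fun t =>
        (invSqRadius_pos hm (hR3 t)).ne'
      simp only [hGdef]
      fun_prop (disch := assumption)
    have hlv : length m a b v = ∫ t in a..b, Real.sqrt (G t) := by
      refine length_eq_of_hasDerivAt hab.le (d₀ := fun t => s * deriv γ t 0)
        (d₁ := fun t => σ * g t) (fun t ht => ?_) (fun t _ => hv1d t) (fun t ht => ?_)
      · exact (((hγ0d t ht).sub_const (3 * m)).const_mul s).const_add (3 * m)
      · have h2 := hcons t ht
        have hR3 := le_shrink hs0 (hr3 t)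
        rw [hv0, one_div_invSqRadius (by linarith), mul_pow, h2.2,
          hrγ t (Set.Ioo_subset_Icc_self ht), hJ2, mul_pow σ, show σ ^ 2 = 1 by rw [sq, hσ2]]
        simp only [hGdef]
        ring
    rw [hlv, hlγ]
    have hwR : ∀ t, 0 < 1 / invSqRadius m (shrink m s (r t)) := fun t =>
      one_div_pos.2 (invSqRadius_pos hm (le_shrink hs0 (hr3 t)))
    refine integral_sqrt_lt hab hE hGc (fun t ht => ?_) ?_
    · exact add_nonneg (mul_nonneg (by positivity) (hkin t ht))
        (mul_nonneg (hwR t).le (sq_nonneg _))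
    -- The shrinking lemmas bound `G`, and `1 / 4` is the least possible square of the angular
    -- factor. The term linear in `δ` integrates to zero by `hμ`; `hgain` compares the other two.
    have hbound : ∫ t in a..b, G t ≤ ∫ t in a..b, (E + j ^ 2 * (2 * δ) * (q t * (r t - μ)) +
        j ^ 2 * δ ^ 2 * (q t * (r t - μ) ^ 2) -
        j ^ 2 * ((1 - s) / 4) * (q t * (1 - 27 * m ^ 2 * q t))) := by
      refine intervalIntegral.integral_mono_on_of_le_Ioo hab.le (hii _ hGc) (hii _ (by fun_prop))
        fun t ht => ?_
      have k1 := mul_le_mul_of_nonneg_right (radial_shrink_le hm hs0 hs1 (hr3 t)) (hkin t ht)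
      have k2 := mul_le_mul_of_nonneg_right (angular_shrink_le hm hs0 hs1 (hr3 t))
        (sq_nonneg (g t))
      have k3 : (s * (1 / q t) + (1 - s) * (27 * m ^ 2)) * g t ^ 2 =
          j ^ 2 * (q t * (1 + δ * (r t - μ)) ^ 2) -
          j ^ 2 * (1 - s) * (q t * (1 - 27 * m ^ 2 * q t)) * (1 + δ * (r t - μ)) ^ 2 := by
        have := (hq0 t).ne'
        simp only [hg]
        field_simp
        ring
      have k4 : 1 / 4 ≤ (1 + δ * (r t - μ)) ^ 2 := by
        nlinarith [hψ t (Set.Ioo_subset_Icc_self ht)]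
      have k5 : 0 ≤ j ^ 2 * (1 - s) * (q t * (1 - 27 * m ^ 2 * q t)) :=
        mul_nonneg (mul_nonneg (sq_nonneg _) (by linarith))
          (mul_nonneg (hq0 t).le (sub_nonneg.2 (invSqRadius_le hm (hr3 t))))
      have k6 := mul_le_mul_of_nonneg_left k4 k5
      change G t ≤ _
      change _ ≤ (s * (1 / q t) + (1 - s) * (27 * m ^ 2)) * g t ^ 2 at k2
      rw [k3] at k2
      simp only [hGdef]
      linarith
    refine hbound.trans_lt ?_
    have c0 : Continuous fun _ : ℝ => E := continuous_const
    have c1 : Continuous fun t => j ^ 2 * (2 * δ) * (q t * (r t - μ)) := by fun_prop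
    have c2 : Continuous fun t => j ^ 2 * δ ^ 2 * (q t * (r t - μ) ^ 2) := by fun_prop
    have c3 : Continuous fun t => j ^ 2 * ((1 - s) / 4) * (q t * (1 - 27 * m ^ 2 * q t)) := by
      fun_prop
    have c01 : Continuous fun t => E + j ^ 2 * (2 * δ) * (q t * (r t - μ)) := by fun_prop
    have c012 : Continuous fun t => E + j ^ 2 * (2 * δ) * (q t * (r t - μ)) +
        j ^ 2 * δ ^ 2 * (q t * (r t - μ) ^ 2) := by fun_prop
    rw [intervalIntegral.integral_sub (hii _ c012) (hii _ c3),
      intervalIntegral.integral_add (hii _ c01) (hii _ c2),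
      intervalIntegral.integral_add (hii _ c0) (hii _ c1),
      intervalIntegral.integral_const_mul, intervalIntegral.integral_const_mul,
      intervalIntegral.integral_const_mul, hμ, intervalIntegral.integral_const (c := E),
      smul_eq_mul]
    have := mul_lt_mul_of_pos_left hgain (pow_pos hj0 2)
    linarith

end SchwarzschildOptical

end

/-! ### Conclusion: constant radius, or a contradiction with minimality. -/

theorem corollary1 (m : ℝ) (hm : 0 < m) (A : ENNReal) (a b : ℝ) (γ : ℝ → Fin 2 → ℝ)
    (hγ : SchwarzschildOptical.IsIsoperimetricSolution m A a b γ)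
    (hray : SchwarzschildOptical.IsLightRayOn m γ (Set.Ioo a b)) :
    ∀ t ∈ Set.Icc a b, γ t 0 = 3 * m := by
  open SchwarzschildOptical in
  have hadm := hγ.admissible
  have hab := hadm.lt
  have hγc := hadm.piecewiseSmooth.continuousOn
  obtain ⟨J, E, hcons⟩ := hray.conserved hm
  obtain ⟨σ, hσ, hw⟩ : ∃ σ : ℝ, (σ = 1 ∨ σ = -1) ∧ γ b 1 = γ a 1 + 2 * Real.pi * σ := by
    rcases hadm.winding with h | h
    · exact ⟨1, Or.inl rfl, by rw [h]; ring⟩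
    · exact ⟨-1, Or.inr rfl, by rw [h]; ring⟩
  -- The radius is extended by its end values, so that continuity and the bound by `3 * m` hold on
  -- all of `ℝ`.
  obtain ⟨r, hr, hr3, hrγ⟩ : ∃ r : ℝ → ℝ, Continuous r ∧ (∀ t, 3 * m ≤ r t) ∧
      ∀ t ∈ Set.Icc a b, γ t 0 = r t := by
    refine ⟨Set.IccExtend hab.le ((Set.Icc a b).domRestrict fun t => γ t 0),
      ((continuousOn_pi.1 hγc) 0).domRestrict.Icc_extend', fun t => hadm.outside _ (Subtype.prop _),
      fun t ht => ?_⟩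
    rw [Set.IccExtend_of_mem _ _ ht]
    rfl
  have hqc : Continuous fun t => invSqRadius m (r t) :=
    (continuousOn_invSqRadius hm).comp_continuous hr hr3
  have hqI : 0 < ∫ t in a..b, invSqRadius m (r t) :=
    intervalIntegral.intervalIntegral_pos_of_pos (hqc.intervalIntegrable _ _)
      (fun t => invSqRadius_pos hm (hr3 t)) hab
  -- The angular velocity `J * invSqRadius` integrates to one full turn, so `J` cannot vanish.
  have hJ : J * ∫ t in a..b, invSqRadius m (r t) = 2 * Real.pi * σ := by
    rw [← intervalIntegral.integral_const_mul, intervalIntegral.integral_eq_sub_of_hasDerivAt_of_le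
      hab.le ((continuousOn_pi.1 hγc) 1) (fun t ht => ?_)
      (Continuous.intervalIntegrable (by fun_prop) _ _), hw]
    · ring
    · rw [← hrγ t (Set.Ioo_subset_Icc_self ht), ← (hcons t ht).1]
      exact (hray.hasDerivAt isOpen_Ioo ht 1).1
  have hJ0 : J ≠ 0 := by
    rintro rfl
    have := Real.pi_pos
    rcases hσ with rfl | rfl <;> linarith
  set μ := (∫ t in a..b, invSqRadius m (r t) * r t) / ∫ t in a..b, invSqRadius m (r t) with hμdef
  have hμ : ∫ t in a..b, invSqRadius m (r t) * (r t - μ) = 0 := by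
    simp only [mul_sub]
    rw [intervalIntegral.integral_sub (Continuous.intervalIntegrable (by fun_prop) _ _)
      (Continuous.intervalIntegrable (by fun_prop) _ _), intervalIntegral.integral_mul_const,
      hμdef, mul_div_cancel₀ _ hqI.ne', sub_self]
  by_cases hconst : ∀ t ∈ Set.Icc a b, r t = μ
  · have hmid : (a + b) / 2 ∈ Set.Ioo a b := ⟨by linarith, by linarith⟩
    have hc : μ = 3 * m := by
      refine hray.eq_of_const hm (fun t ht => ?_) hmid ?_
      · rw [hrγ t (Set.Ioo_subset_Icc_self ht), hconst t (Set.Ioo_subset_Icc_self ht)]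
      · rw [(hcons _ hmid).1, hrγ _ (Set.Ioo_subset_Icc_self hmid)]
        exact mul_ne_zero hJ0 (invSqRadius_pos hm (hr3 _)).ne'
    intro t ht
    rw [hrγ t ht, hconst t ht, hc]
  · push Not at hconst
    obtain ⟨v, hv, hvA, hvl⟩ :=
      hray.exists_shorter hm hadm hcons hσ hw hr hr3 hrγ hJ hμ hconst
    exact absurd (hγ.length_le a b v hv (hvA.trans hγ.area_eq)) (not_le.2 hvl)
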